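/- **Theorem 4.1 (Eigenvalue Level Spacing Estimate).** Let $d,r\ge 1$ be integers. Let $(H_0f)(n)=2d\,f(n)-\sum_{|k-n|=1}f(k)$ be the positive discrete Laplacian on $\mathbb Z^d$, and for $n\in\mathbb Z^d$ put $\Lambda_s(n)=\prod_{j=1}^d\{n_j,\dots,n_j+s-1\}$. Let $(\omega_k)_{k\in r\mathbb Z^d}$ be independent random variables with a common probability density $\rho$ which vanishes outside $[0,1]$ and which on $[0,1]$ is Lipschitz continuous with $0<\rho_-<\rho<\rho_+<\infty$ for some constants $\rho_\pm$. For $L\in r\mathbb N$, let $\Lambda_L=\Lambda_L(a)$ with $a\in r\mathbb Z^d$ be a cube of side length $L$, so that $\Lambda_L$ is the disjoint union of the blocks $\Lambda_r(k)$, $k\in\Lambda^*_{r,L}:=\Lambda_L\cap r\mathbb Z^d$, and let $$H_\omega^L=\chi_{\Lambda_L}H_0\chi_{\Lambda_L}+\sum_{k\in\Lambda^*_{r,L}}\omega_k\,\chi_{\Lambda_r(k)}\quad\text{on }\ell^2(\Lambda_L).$$ For a set $I\subset\mathbb R$, let $\mathrm{spac}_I(H_\omega^L)=\min_{j\ne k}\{|E_j-E_k|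 : E_j,E_k\in I\}$, where $(E_j)$ are the eigenvalues of $H_\omega^L$ listed with multiplicity, and $\min\emptyset=+\infty$. Let $0<E<\gamma_{\infty,r}:=1-\cos(\pi/r)$ and $I_E=[0,E]\cup[4d+1-E,4d+1]$. Then for every $p>0$ there are constants $\mathcal L_{sp}>0$ and $C_{sp}>0$, depending only on $E$, $p$ and the model parameters $d,r,\rho$, such that $$\mathbb P\{\mathrm{spac}_{I_E}(H^L_\omega)<\delta\}\le C_{sp}\,L^{2d}\,|\log\delta|^{-p}$$ for all $L\in r\mathbb N$ with $L\ge\mathcal L_{sp}$, all $a \in r\mathbb Z^d$, and all $0<\delta\le\exp(-(\log L)^5)$. -/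

import Mathlib

open MeasureTheory ProbabilityTheory

noncomputable section

namespace AndersonModel

/-- The points of the sublattice `r ℤ^d` of `ℤ^d`. -/
abbrev Sublattice (d r : ℕ) : Type := {k : Fin d → ℤ // ∀ j, (r : ℤ) ∣ k j}

/-- The discrete cube `∏ j, {n j, …, n j + s - 1}` of side length `s` and vertex `n` in `ℤ^d`. -/
def cube {d : ℕ} (s : ℕ) (n : Fin d → ℤ) : Finset (Fin d → ℤ) :=
  Fintype.piFinset fun j => Finset.Ico (n j) (n j + s)

/-- The positive discrete Laplacian `(H₀ f)(n) = 2 d f(n) - ∑_{|k - n| = 1} f(k)` on `ℤ^d`;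
the points `k` with `|k - n| = 1` are `n ± e_j`. -/
def freeHamiltonian {d : ℕ} (f : (Fin d → ℤ) → ℝ) (n : Fin d → ℤ) : ℝ :=
  2 * d * f n - ∑ j : Fin d, (f (n + Pi.single j 1) + f (n - Pi.single j 1))

/-- The restriction `χ_Λ H₀ χ_Λ` of the Laplacian to a finite set `Λ` (simple boundary conditions),
as a matrix in the canonical basis `(δ_x)` of `ℓ²(Λ)`: the entry is `(H₀ δ_y)(x)`. -/
def localFreeHamiltonian {d : ℕ} (Λ : Finset (Fin d → ℤ)) : Matrix Λ Λ ℝ :=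
  Matrix.of fun x y => freeHamiltonian (Pi.single (y : Fin d → ℤ) 1) x

/-- The index set `Λ* = Λ ∩ r ℤ^d` of the blocks of side length `r` making up `Λ`. -/
def blockIndex {d : ℕ} (r : ℕ) (Λ : Finset (Fin d → ℤ)) : Finset (Sublattice d r) :=
  Λ.subtype fun k => ∀ j, (r : ℤ) ∣ k j

/-- The projection `χ_{Λ_r(k)}` onto the sites of the block `Λ_r(k)`, acting on `ℓ²(Λ)`. -/
def blockProjection {d r : ℕ} (Λ : Finset (Fin d → ℤ)) (k : Sublattice d r) : Matrix Λ Λ ℝ :=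
  Matrix.diagonal fun x => if (x : Fin d → ℤ) ∈ cube r k.1 then 1 else 0

/-- The local potential `∑_{k ∈ Λ*} ω_k χ_{Λ_r(k)}`. -/
def localPotential {d r : ℕ} (Λ : Finset (Fin d → ℤ)) (ω : Sublattice d r → ℝ) : Matrix Λ Λ ℝ :=
  ∑ k ∈ blockIndex r Λ, ω k • blockProjection Λ k

/-- The local Schrödinger operator `χ_Λ H₀ χ_Λ + ∑_{k ∈ Λ*} ω_k χ_{Λ_r(k)}` on `ℓ²(Λ)`. It is a real
symmetric matrix, so its eigenvalues and their multiplicities are the same over `ℝ` and `ℂ`. -/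
def localHamiltonian {d r : ℕ} (Λ : Finset (Fin d → ℤ)) (ω : Sublattice d r → ℝ) : Matrix Λ Λ ℝ :=
  localFreeHamiltonian Λ + localPotential Λ ω

theorem isHermitian_localFreeHamiltonian {d : ℕ} (Λ : Finset (Fin d → ℤ)) :
    (localFreeHamiltonian Λ).IsHermitian := by
  ext x y
  simp only [localFreeHamiltonian, freeHamiltonian, Matrix.conjTranspose_apply, Matrix.of_apply,
    star_trivial]
  have h0 : (Pi.single (x : Fin d → ℤ) (1 : ℝ) : (Fin d → ℤ) → ℝ) y
      = (Pi.single (y : Fin d → ℤ) (1 : ℝ) : (Fin d → ℤ) → ℝ) x := by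
    simp only [Pi.single_apply, eq_comm]
  have h1 : ∀ (a b v : Fin d → ℤ), (Pi.single a (1 : ℝ) : (Fin d → ℤ) → ℝ) (b + v)
      = (Pi.single b (1 : ℝ) : (Fin d → ℤ) → ℝ) (a - v) := by
    intro a b v
    have : b + v = a ↔ a - v = b := by
      constructor
      · intro h; rw [← h]; abel
      · intro h; rw [← h]; abel
    simp only [Pi.single_apply, this]
  rw [h0]
  congr 1
  refine Finset.sum_congr rfl fun j _ => ?_
  rw [h1, ← h1 y x]
  ring

theorem isHermitian_localHamiltonian {d r : ℕ} (Λ : Finset (Fin d → ℤ))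
    (ω : Sublattice d r → ℝ) : (localHamiltonian Λ ω).IsHermitian := by
  refine (isHermitian_localFreeHamiltonian Λ).add ?_
  ext x y
  simp only [localPotential, blockProjection, Matrix.conjTranspose_apply, star_trivial,
    Matrix.sum_apply, Matrix.smul_apply]
  refine Finset.sum_congr rfl fun k _ => ?_
  by_cases h : x = y
  · rw [h]
  · rw [Matrix.diagonal_apply_ne _ h, Matrix.diagonal_apply_ne _ (Ne.symm h)]

/-- The eigenvalue level spacing `min_{j ≠ k} {|E_j - E_k| : E_j, E_k ∈ I}` of a Hermitian matrix in
`I`, where `(E_j)` lists the eigenvalues with multiplicity. The minimum over the empty set, which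
occurs if there are fewer than two eigenvalues in `I`, is `+∞`. -/
def levelSpacing {ι : Type*} [Fintype ι] [DecidableEq ι] (I : Set ℝ) {A : Matrix ι ι ℝ}
    (hA : A.IsHermitian) : EReal :=
  ⨅ (j : ι) (k : ι) (_ : j ≠ k) (_ : hA.eigenvalues j ∈ I) (_ : hA.eigenvalues k ∈ I),
    ((|hA.eigenvalues j - hA.eigenvalues k| : ℝ) : EReal)

/-- Single-site densities: probability densities which vanish outside `[0,1]` and which, on `[0,1]`,
are Lipschitz continuous and bounded from above and below by positive constants. -/
structure IsSingleSiteDensity (ρ : ℝ → ℝ) : Prop where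
  support_eq : Function.support ρ = Set.Icc 0 1
  lipschitz : ∃ K : ℝ, 0 < K ∧ ∀ x ∈ Set.Icc (0 : ℝ) 1, ∀ y ∈ Set.Icc (0 : ℝ) 1,
    |ρ x - ρ y| ≤ K * |x - y|
  bounds : ∃ a b : ℝ, 0 < a ∧ ∀ x ∈ Set.Icc (0 : ℝ) 1, a < ρ x ∧ ρ x < b
  lintegral_eq_one : ∫⁻ x, ENNReal.ofReal (ρ x) = 1

/-- The random variables `ω_k`, `k ∈ r ℤ^d`, are independent with common density `ρ`. -/
structure IsRandomCoupling {Ω : Type*} [MeasurableSpace Ω] (P : Measure Ω) {d r : ℕ} (ρ : ℝ → ℝ)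
    (ω : Sublattice d r → Ω → ℝ) : Prop where
  measurable : ∀ k, Measurable (ω k)
  indep : iIndepFun ω P
  law : ∀ k, P.map (ω k) = volume.withDensity fun x => ENNReal.ofReal (ρ x)

/-- The union `I_E = [0, E] ∪ [4d + 1 - E, 4d + 1]` of energy intervals at the two band edges. -/
def bandEdges (d : ℕ) (E : ℝ) : Set ℝ := Set.Icc 0 E ∪ Set.Icc (4 * d + 1 - E) (4 * d + 1)

end AndersonModel

end

noncomputable section

namespace AndersonModel

open Matrix

/-- Discrete Dirichlet inequality on a segment, by comparison with the ground state. -/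
theorem dirichlet_path_aux (n : ℕ) (hn : 2 ≤ n) (S : ℕ → ℝ) (h0 : S 0 = 0) (m : ℕ) (hm : m + 1 < n) :
    (2 - 2 * Real.cos (Real.pi / n)) * ∑ i ∈ Finset.range (m + 1), S (i + 1) ^ 2
      + (1 - Real.sin ((m + 2) * (Real.pi / n)) / Real.sin ((m + 1) * (Real.pi / n)))
        * (- S (m + 1) ^ 2)
      ≤ ∑ i ∈ Finset.range (m + 1), (S (i + 1) - S i) ^ 2 := by
  set θ := Real.pi / n with hθ
  have hn' : (0 : ℝ) < n := by positivity
  have hpos : ∀ j : ℕ, j + 1 < n → 0 < Real.sin ((j + 1) * θ) := by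
    intro j hj
    have h1 : ((j : ℝ) + 1) < n := by exact_mod_cast hj
    apply Real.sin_pos_of_pos_of_lt_pi
    · positivity
    · rw [hθ, ← mul_div_assoc, div_lt_iff₀ hn', mul_comm]
      exact mul_lt_mul_of_pos_left h1 Real.pi_pos
  have hrec : ∀ x : ℝ, Real.sin ((x + 2) * θ) = 2 * Real.cos θ * Real.sin ((x + 1) * θ)
      - Real.sin (x * θ) := by
    intro x
    have e1 : (x + 2) * θ = (x + 1) * θ + θ := by ring
    have e2 : x * θ = (x + 1) * θ - θ := by ring
    rw [e1, e2, Real.sin_add, Real.sin_sub]; ring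
  induction m with
  | zero =>
    have hp := hpos 0 (by omega)
    have := hrec 0
    simp only [zero_mul, Real.sin_zero, zero_add, one_mul, sub_zero] at this
    simp only [Nat.cast_zero, zero_add, one_mul] at hp ⊢
    rw [this, mul_div_assoc, div_self hp.ne']
    simp [h0]
    nlinarith [sq_nonneg (S 1)]
  | succ m ih =>
    have ih := ih (by omega)
    have hp := hpos m (by omega)
    have hp1 := hpos (m + 1) (by omega)
    push_cast at hp1 ⊢
    have hr := hrec (m + 1)
    rw [show (m : ℝ) + 1 + 1 = m + 2 by ring] at hp1 hr ⊢
    rw [Finset.sum_range_succ, Finset.sum_range_succ (fun i => (S (i + 1) - S i) ^ 2)]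
    rw [hr]
    set a := Real.sin ((m + 1) * θ)
    set b := Real.sin ((m + 2) * θ)
    have e3 : (2 * Real.cos θ * b - a) / b = 2 * Real.cos θ - a / b := by field_simp
    rw [e3]
    have key : 0 ≤ b / a * S (m + 1) ^ 2 + a / b * S (m + 1 + 1) ^ 2
        - 2 * S (m + 1) * S (m + 1 + 1) := by
      have : b / a * S (m + 1) ^ 2 + a / b * S (m + 1 + 1) ^ 2
        - 2 * S (m + 1) * S (m + 1 + 1) = (b * S (m + 1) - a * S (m + 1 + 1)) ^ 2 / (a * b) := by
        field_simp
        ring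
      rw [this]; positivity
    nlinarith

/-- Sharp discrete Dirichlet inequality on a segment. -/
theorem dirichlet_path (n : ℕ) (hn : 2 ≤ n) (S : ℕ → ℝ) (h0 : S 0 = 0) (hS : S n = 0) :
    (2 - 2 * Real.cos (Real.pi / n)) * ∑ i ∈ Finset.range n, S (i + 1) ^ 2
      ≤ ∑ i ∈ Finset.range n, (S (i + 1) - S i) ^ 2 := by
  obtain ⟨m, rfl⟩ : ∃ m, n = m + 2 := ⟨n - 2, by omega⟩
  have h := dirichlet_path_aux (m + 2) hn S h0 m (by omega)
  have e : ((m : ℝ) + 2) * (Real.pi / ((m + 2 : ℕ) : ℝ)) = Real.pi := by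
    push_cast; field_simp
  rw [e, Real.sin_pi, zero_div, sub_zero, one_mul] at h
  rw [Finset.sum_range_succ, Finset.sum_range_succ (fun i => (S (i + 1) - S i) ^ 2), hS]
  nlinarith

/-- Sharp Poincaré inequality on a path with `n` vertices. -/
theorem poincare_path (n : ℕ) (f : ℕ → ℝ) (hf : ∑ i ∈ Finset.range n, f i = 0) :
    2 * (1 - Real.cos (Real.pi / n)) * ∑ i ∈ Finset.range n, f i ^ 2
      ≤ ∑ i ∈ Finset.range (n - 1), (f (i + 1) - f i) ^ 2 := by
  rcases Nat.lt_or_ge n 2 with hn | hn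
  · interval_cases n
    · simp
    · simp at hf; simp [hf]
  obtain ⟨m, rfl⟩ : ∃ m, n = m + 1 := ⟨n - 1, by omega⟩
  set S : ℕ → ℝ := fun j => ∑ i ∈ Finset.range j, f i with hSdef
  have hS0 : S 0 = 0 := by simp [hSdef]
  have hSn : S (m + 1) = 0 := hf
  have hd : ∀ i, S (i + 1) - S i = f i := fun i => by simp [hSdef, Finset.sum_range_succ]
  have hD := dirichlet_path (m + 1) hn S hS0 hSn
  simp only [hd] at hD
  have hlam : 0 ≤ 2 - 2 * Real.cos (Real.pi / ((m + 1 : ℕ) : ℝ)) := by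
    linarith [Real.cos_le_one (Real.pi / ((m + 1 : ℕ) : ℝ))]
  set lam := 2 - 2 * Real.cos (Real.pi / ((m + 1 : ℕ) : ℝ)) with hlamdef
  have hparts : ∀ j, ∑ i ∈ Finset.range j, S (i + 1) * (f (i + 1) - f i)
      = S j * f j - ∑ i ∈ Finset.range j, f i ^ 2 := by
    intro j
    induction j with
    | zero => simp [hS0]
    | succ j ih =>
      rw [Finset.sum_range_succ, ih, Finset.sum_range_succ (fun i => f i ^ 2)]
      have := hd j
      have e : S (j + 1) = S j + f j := by linarith
      rw [e]; ring
  have hp := hparts m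
  have hSm : S m = - f m := by have := hd m; linarith
  have hp' : ∑ i ∈ Finset.range m, S (i + 1) * (f (i + 1) - f i)
      = - ∑ i ∈ Finset.range (m + 1), f i ^ 2 := by
    rw [hp, Finset.sum_range_succ, hSm]; ring
  have hcs := Finset.sum_mul_sq_le_sq_mul_sq (Finset.range m) (fun i => S (i + 1))
    (fun i => f (i + 1) - f i)
  rw [hp'] at hcs
  have hSS : ∑ i ∈ Finset.range m, S (i + 1) ^ 2 = ∑ i ∈ Finset.range (m + 1), S (i + 1) ^ 2 := by
    rw [Finset.sum_range_succ, hSn]; ring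
  rw [hSS] at hcs
  simp only [Nat.add_sub_cancel]
  set X := ∑ i ∈ Finset.range (m + 1), f i ^ 2
  set Y := ∑ i ∈ Finset.range m, (f (i + 1) - f i) ^ 2
  set Z := ∑ i ∈ Finset.range (m + 1), S (i + 1) ^ 2
  have hX : 0 ≤ X := Finset.sum_nonneg fun _ _ => sq_nonneg _
  have hY : 0 ≤ Y := Finset.sum_nonneg fun _ _ => sq_nonneg _
  have e2 : 2 * (1 - Real.cos (Real.pi / ((m + 1 : ℕ) : ℝ))) = lam := by rw [hlamdef]; ring
  rw [e2]
  rcases hX.eq_or_lt with h | h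
  · rw [← h]; simpa using hY
  · have h1 : lam * X * X ≤ Y * X := by nlinarith
    exact le_of_mul_le_mul_right h1 h

/-- Dirichlet form of a function on the discrete box `Fin d → Fin r`. -/
def boxEnergy (d r : ℕ) (f : (Fin d → Fin r) → ℝ) : ℝ :=
  ∑ y : Fin d → Fin r, ∑ j : Fin d, ∑ q : Fin r,
    if (y j : ℕ) + 1 = q then (f (Function.update y j q) - f y) ^ 2 else 0

theorem poincare_fin (r : ℕ) (f : Fin r → ℝ) (hf : ∑ i, f i = 0) :
    2 * (1 - Real.cos (Real.pi / r)) * ∑ i, f i ^ 2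
      ≤ ∑ i : Fin r, ∑ q : Fin r, if (i : ℕ) + 1 = q then (f q - f i) ^ 2 else 0 := by
  set g : ℕ → ℝ := fun i => if h : i < r then f ⟨i, h⟩ else 0
  have hg : ∀ i : Fin r, f i = g i := fun i => by simp [g]
  have h := poincare_path r g (by rw [← Fin.sum_univ_eq_sum_range]; simpa only [hg] using hf)
  rw [← Fin.sum_univ_eq_sum_range (fun i => g i ^ 2)] at h
  simp only [hg]
  refine h.trans (le_of_eq ?_)
  have : ∀ i : Fin r, (∑ q : Fin r, if (i : ℕ) + 1 = q then (g q - g i) ^ 2 else 0)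
      = if (i : ℕ) + 1 < r then (g (i + 1) - g i) ^ 2 else 0 := by
    intro i
    split_ifs with hi
    · rw [Finset.sum_eq_single ⟨i + 1, hi⟩]
      · simp
      · intro b _ hb
        rw [if_neg]
        intro e; apply hb; ext; simp [e]
      · simp
    · apply Finset.sum_eq_zero
      intro q _
      rw [if_neg]
      have := q.2
      omega
  simp only [this]
  rw [Fin.sum_univ_eq_sum_range (fun i => if i + 1 < r then (g (i + 1) - g i) ^ 2 else 0) r]
  rw [← Finset.sum_filter]
  congr 1
  ext i
  simp; omega

/-- Sharp Poincaré inequality on the discrete box `Fin d → Fin r`. -/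
theorem poincare_box (d r : ℕ) (f : (Fin d → Fin r) → ℝ) (hf : ∑ y, f y = 0) :
    2 * (1 - Real.cos (Real.pi / r)) * ∑ y, f y ^ 2 ≤ boxEnergy d r f := by
  have hlam : 0 ≤ 2 * (1 - Real.cos (Real.pi / r)) := by
    linarith [Real.cos_le_one (Real.pi / r)]
  set lam := 2 * (1 - Real.cos (Real.pi / r)) with hlamdef
  induction d with
  | zero =>
    have : f default = 0 := by simpa using hf
    simp [boxEnergy, Subsingleton.elim _ (default : Fin 0 → Fin r), this]
  | succ d ih =>
    rcases Nat.eq_zero_or_pos r with hr | hr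
    · subst hr; simp [boxEnergy]
    have hr' : (0 : ℝ) < r := by exact_mod_cast hr
    have split : ∀ F : (Fin (d + 1) → Fin r) → ℝ,
        ∑ y, F y = ∑ z : Fin d → Fin r, ∑ i : Fin r, F (Fin.cons i z) := by
      intro F
      rw [← (Fin.consEquiv fun _ => Fin r).sum_comp F, Fintype.sum_prod_type_right]
      rfl
    set g : (Fin d → Fin r) → ℝ := fun z => (∑ i : Fin r, f (Fin.cons i z)) / r with hg
    have hgs : ∀ z, ∑ i : Fin r, f (Fin.cons i z) = r * g z := fun z => by
      rw [hg]; field_simp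
    have hg0 : ∑ z, g z = 0 := by
      rw [split] at hf
      simp only [hg, ← Finset.sum_div, hf, zero_div]
    have ihg := ih g hg0
    have h1 : ∑ y, f y ^ 2 = (∑ z, ∑ i : Fin r, (f (Fin.cons i z) - g z) ^ 2)
        + r * ∑ z, g z ^ 2 := by
      rw [split, Finset.mul_sum, ← Finset.sum_add_distrib]
      refine Finset.sum_congr rfl fun z _ => ?_
      have : ∀ i : Fin r, (f (Fin.cons i z) - g z) ^ 2
          = f (Fin.cons i z) ^ 2 - 2 * g z * f (Fin.cons i z) + g z ^ 2 := fun i => by ring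
      simp only [this, Finset.sum_add_distrib, Finset.sum_sub_distrib, ← Finset.mul_sum, hgs]
      simp
      ring
    have h2 : boxEnergy (d + 1) r f
        = (∑ z : Fin d → Fin r, ∑ i : Fin r, ∑ q : Fin r,
            if (i : ℕ) + 1 = q then (f (Fin.cons q z) - f (Fin.cons i z)) ^ 2 else 0)
        + ∑ i : Fin r, boxEnergy d r fun z => f (Fin.cons i z) := by
      simp only [boxEnergy]
      rw [split, Finset.sum_comm (s := (Finset.univ : Finset (Fin r))), ← Finset.sum_add_distrib]
      refine Finset.sum_congr rfl fun z _ => ?_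
      rw [← Finset.sum_add_distrib]
      refine Finset.sum_congr rfl fun i _ => ?_
      rw [Fin.sum_univ_succ]
      simp only [Fin.cons_zero, Fin.update_cons_zero, Fin.cons_succ, Fin.cons_update]
    have h3 : lam * ∑ z, ∑ i : Fin r, (f (Fin.cons i z) - g z) ^ 2
        ≤ ∑ z : Fin d → Fin r, ∑ i : Fin r, ∑ q : Fin r,
            if (i : ℕ) + 1 = q then (f (Fin.cons q z) - f (Fin.cons i z)) ^ 2 else 0 := by
      rw [Finset.mul_sum]
      refine Finset.sum_le_sum fun z _ => ?_
      have := poincare_fin r (fun i => f (Fin.cons i z) - g z) (by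
        rw [Finset.sum_sub_distrib, hgs]; simp)
      simpa only [sub_sub_sub_cancel_right] using this
    have h4 : r * boxEnergy d r g ≤ ∑ i : Fin r, boxEnergy d r fun z => f (Fin.cons i z) := by
      simp only [boxEnergy]
      rw [Finset.mul_sum, Finset.sum_comm]
      refine Finset.sum_le_sum fun z _ => ?_
      rw [Finset.mul_sum, Finset.sum_comm]
      refine Finset.sum_le_sum fun j _ => ?_
      rw [Finset.mul_sum, Finset.sum_comm]
      refine Finset.sum_le_sum fun q _ => ?_
      split_ifs
      · have hj := sq_sum_le_card_mul_sum_sq (s := (Finset.univ : Finset (Fin r)))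
          (f := fun i => f (Fin.cons i (Function.update z j q)) - f (Fin.cons i z))
        rw [Finset.sum_sub_distrib, hgs, hgs, Finset.card_univ, Fintype.card_fin] at hj
        refine le_of_mul_le_mul_left ?_ hr'
        refine le_trans (le_of_eq ?_) hj
        ring
      · simp
    rw [h1, h2]
    have := mul_le_mul_of_nonneg_left ihg hr'.le
    nlinarith

section EuclNorm

variable {n : Type*} [Fintype n]

/-- The Euclidean norm of a vector. -/
def euclNorm (v : n → ℝ) : ℝ := ‖(WithLp.toLp 2 v : EuclideanSpace ℝ n)‖

theorem euclNorm_sq (v : n → ℝ) : euclNorm v ^ 2 = v ⬝ᵥ v := by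
  rw [euclNorm, ← real_inner_self_eq_norm_sq, EuclideanSpace.inner_eq_star_dotProduct]; simp

theorem euclNorm_nonneg (v : n → ℝ) : 0 ≤ euclNorm v := norm_nonneg _

theorem euclNorm_add_le (v w : n → ℝ) : euclNorm (v + w) ≤ euclNorm v + euclNorm w := by
  simp only [euclNorm, WithLp.toLp_add]; exact norm_add_le _ _

theorem euclNorm_smul (c : ℝ) (v : n → ℝ) : euclNorm (c • v) = |c| * euclNorm v := by
  simp only [euclNorm, WithLp.toLp_smul, norm_smul, Real.norm_eq_abs]

theorem abs_dotProduct_le (v w : n → ℝ) : |v ⬝ᵥ w| ≤ euclNorm v * euclNorm w := by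
  have h := abs_real_inner_le_norm (WithLp.toLp 2 v : EuclideanSpace ℝ n) (WithLp.toLp 2 w)
  rwa [EuclideanSpace.inner_eq_star_dotProduct, star_trivial, dotProduct_comm] at h

theorem mulVec_dotProduct_comm {A : Matrix n n ℝ} (hA : A.IsHermitian) (v w : n → ℝ) :
    (A *ᵥ v) ⬝ᵥ w = v ⬝ᵥ (A *ᵥ w) := by
  rw [dotProduct_mulVec, ← mulVec_transpose]
  congr 2
  ext i j
  exact (hA.apply i j).symm

end EuclNorm

section Spectral

variable {n : Type*} [Fintype n] [DecidableEq n] {A B : Matrix n n ℝ}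

/-- The eigenvectors of a Hermitian matrix, in the order of `Matrix.IsHermitian.eigenvalues₀`. -/
def sortedEigenvector (hA : A.IsHermitian) (i : Fin (Fintype.card n)) : n → ℝ :=
  ⇑(hA.eigenvectorBasis (Fintype.equivOfCardEq (Fintype.card_fin _) i))

theorem eigenvalues_equiv (hA : A.IsHermitian) (i : Fin (Fintype.card n)) :
    hA.eigenvalues (Fintype.equivOfCardEq (Fintype.card_fin _) i) = hA.eigenvalues₀ i := by
  simp [IsHermitian.eigenvalues]

theorem mulVec_sortedEigenvector (hA : A.IsHermitian) (i : Fin (Fintype.card n)) :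
    A *ᵥ sortedEigenvector hA i = hA.eigenvalues₀ i • sortedEigenvector hA i := by
  rw [← eigenvalues_equiv]
  exact hA.mulVec_eigenvectorBasis _

theorem sortedEigenvector_dotProduct (hA : A.IsHermitian) (i j : Fin (Fintype.card n)) :
    sortedEigenvector hA i ⬝ᵥ sortedEigenvector hA j = if i = j then 1 else 0 := by
  have h := orthonormal_iff_ite.mp hA.eigenvectorBasis.orthonormal
    (Fintype.equivOfCardEq (Fintype.card_fin _) j) (Fintype.equivOfCardEq (Fintype.card_fin _) i)
  rw [EuclideanSpace.inner_eq_star_dotProduct] at h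
  simp only [star_trivial, EmbeddingLike.apply_eq_iff_eq] at h
  simp only [sortedEigenvector]
  rw [h]
  simp [eq_comm]

theorem sum_sortedEigenvector (hA : A.IsHermitian) (v : n → ℝ) :
    ∑ i, (v ⬝ᵥ sortedEigenvector hA i) • sortedEigenvector hA i = v := by
  have h := hA.eigenvectorBasis.sum_repr (WithLp.toLp 2 v)
  have h2 := congrArg WithLp.ofLp h
  rw [WithLp.ofLp_sum] at h2
  simp only [WithLp.ofLp_smul, OrthonormalBasis.repr_apply_apply,
    EuclideanSpace.inner_eq_star_dotProduct, star_trivial] at h2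
  rw [← (Fintype.equivOfCardEq (Fintype.card_fin (Fintype.card n))).sum_comp] at h2
  exact h2

theorem dotProduct_eq_sum (hA : A.IsHermitian) (v w : n → ℝ) :
    v ⬝ᵥ w = ∑ i, (v ⬝ᵥ sortedEigenvector hA i) * (w ⬝ᵥ sortedEigenvector hA i) := by
  conv_lhs => rw [← sum_sortedEigenvector hA v]
  rw [sum_dotProduct]
  simp only [smul_dotProduct, smul_eq_mul, dotProduct_comm w]

theorem mulVec_dotProduct_sortedEigenvector (hA : A.IsHermitian) (v : n → ℝ)
    (i : Fin (Fintype.card n)) :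
    (A *ᵥ v) ⬝ᵥ sortedEigenvector hA i = hA.eigenvalues₀ i * (v ⬝ᵥ sortedEigenvector hA i) := by
  rw [mulVec_dotProduct_comm hA, mulVec_sortedEigenvector, dotProduct_smul, smul_eq_mul]

/-- Weyl's inequalities: comparison of the sorted (decreasing) eigenvalues of two matrices whose
quadratic forms are comparable on the vectors vanishing on a small set of sites. -/
theorem eigenvalues₀_le_of_form_le (hA : A.IsHermitian) (hB : B.IsHermitian) (S : Finset n) (t : ℝ)
    (h : ∀ v : n → ℝ, (∀ x ∈ S, v x = 0) → v ⬝ᵥ (A *ᵥ v) ≤ v ⬝ᵥ (B *ᵥ v) + t * (v ⬝ᵥ v))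
    (i j : Fin (Fintype.card n)) (hij : (i : ℕ) + S.card ≤ j) :
    hA.eigenvalues₀ j ≤ hB.eigenvalues₀ i + t := by
  let vec : (Fin (j + 1) → ℝ) →ₗ[ℝ] (n → ℝ) :=
    Fintype.linearCombination ℝ fun l : Fin (j + 1) =>
      sortedEigenvector hA ⟨l, lt_of_le_of_lt (Nat.lt_succ_iff.mp l.2) j.2⟩
  let F : (Fin (j + 1) → ℝ) →ₗ[ℝ] (S → ℝ) × (Fin i → ℝ) :=
    { toFun := fun c => (fun x => vec c x,
        fun m => vec c ⬝ᵥ sortedEigenvector hB ⟨m, m.2.trans i.2⟩)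
      map_add' := by
        intro a b; ext <;> simp [add_dotProduct]
      map_smul' := by
        intro a b; ext <;> simp [smul_dotProduct] }
  have hlt : Module.finrank ℝ ((S → ℝ) × (Fin i → ℝ)) < Module.finrank ℝ (Fin (j + 1) → ℝ) := by
    simp; omega
  obtain ⟨c, hc, hc0⟩ := (Submodule.ne_bot_iff _).mp (LinearMap.ker_ne_bot_of_finrank_lt (f := F) hlt)
  have hFc : F c = 0 := hc
  set v := vec c with hv
  have hvS : ∀ x ∈ S, v x = 0 := fun x hx => congrFun (congrArg Prod.fst hFc) ⟨x, hx⟩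
  have hvB : ∀ m : Fin (Fintype.card n), m < i → v ⬝ᵥ sortedEigenvector hB m = 0 := fun m hm =>
    congrFun (congrArg Prod.snd hFc) ⟨m, hm⟩
  have hvsum : v = ∑ l : Fin (j + 1), c l •
      sortedEigenvector hA ⟨l, lt_of_le_of_lt (Nat.lt_succ_iff.mp l.2) j.2⟩ := rfl
  have hvA : ∀ m : Fin (Fintype.card n), v ⬝ᵥ sortedEigenvector hA m
      = if h : (m : ℕ) < j + 1 then c ⟨m, h⟩ else 0 := by
    intro m
    rw [hvsum, sum_dotProduct]
    simp only [smul_dotProduct, sortedEigenvector_dotProduct, smul_eq_mul, mul_ite, mul_one, mul_zero]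
    split_ifs with hm
    · rw [Finset.sum_eq_single ⟨m, hm⟩]
      · simp
      · intro b _ hb
        rw [if_neg]
        intro e; apply hb; ext; simp [← e]
      · simp
    · apply Finset.sum_eq_zero
      intro l _
      rw [if_neg]
      intro e
      have := l.2
      rw [← e] at hm
      simp at hm; omega
  have hpos : 0 < v ⬝ᵥ v := by
    obtain ⟨l, hl⟩ := Function.ne_iff.mp hc0
    have hl' : v ⬝ᵥ sortedEigenvector hA ⟨l, lt_of_le_of_lt (Nat.lt_succ_iff.mp l.2) j.2⟩ ≠ 0 := by
      rw [hvA, dif_pos l.2]; exact hl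
    rw [dotProduct_eq_sum hA]
    exact Finset.sum_pos' (fun _ _ => mul_self_nonneg _) ⟨_, Finset.mem_univ _, mul_self_pos.mpr hl'⟩
  have h1 : hA.eigenvalues₀ j * (v ⬝ᵥ v) ≤ v ⬝ᵥ (A *ᵥ v) := by
    rw [dotProduct_eq_sum hA, dotProduct_eq_sum hA v (A *ᵥ v), Finset.mul_sum]
    refine Finset.sum_le_sum fun m _ => ?_
    rw [mulVec_dotProduct_sortedEigenvector]
    by_cases hm : (m : ℕ) < j + 1
    · have := hA.eigenvalues₀_antitone (show m ≤ j from Nat.lt_succ_iff.mp hm)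
      nlinarith [mul_self_nonneg (v ⬝ᵥ sortedEigenvector hA m)]
    · rw [hvA, dif_neg hm]; simp
  have h2 : v ⬝ᵥ (B *ᵥ v) ≤ hB.eigenvalues₀ i * (v ⬝ᵥ v) := by
    rw [dotProduct_eq_sum hB, dotProduct_eq_sum hB v v, Finset.mul_sum]
    refine Finset.sum_le_sum fun m _ => ?_
    rw [mulVec_dotProduct_sortedEigenvector]
    rcases lt_or_ge m i with hm | hm
    · rw [hvB m hm]; simp
    · have := hB.eigenvalues₀_antitone hm
      nlinarith [mul_self_nonneg (v ⬝ᵥ sortedEigenvector hB m)]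
  have h3 := h v hvS
  refine le_of_mul_le_mul_right ?_ hpos
  nlinarith

theorem eigenvalues₀_eq_of_eigenvector (hA : A.IsHermitian) (i : Fin (Fintype.card n)) :
    sortedEigenvector hA i ⬝ᵥ (A *ᵥ sortedEigenvector hA i) = hA.eigenvalues₀ i := by
  rw [mulVec_sortedEigenvector, dotProduct_smul, sortedEigenvector_dotProduct]; simp

/-- If a cluster of eigenvalues of `B = A + s D` is isolated, then an approximate eigenvector `v` of
`A` with nearby approximate eigenvalue sees `D` almost as the constant by which the cluster
moves, divided by `s`. -/
theorem abs_form_sub_le (hB : B.IsHermitian) {D : Matrix n n ℝ}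
    {s x x' ε g : ℝ} (hBA : B = A + s • D) (hs : s ≠ 0) (hg : 0 < g)
    (hε : 0 ≤ ε) (J : Set (Fin (Fintype.card n))) [DecidablePred (· ∈ J)]
    (hJ : ∀ m ∈ J, |hB.eigenvalues₀ m - x'| ≤ ε) (hJ' : ∀ m ∉ J, g ≤ |hB.eigenvalues₀ m - x'|)
    (v : n → ℝ) (hv : v ⬝ᵥ v = 1) (hAv : euclNorm (A *ᵥ v - x • v) ≤ ε)
    (hD : euclNorm (D *ᵥ v) ≤ 1) (hx : |x - x'| ≤ |s| + 2 * ε) :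
    |v ⬝ᵥ (D *ᵥ v) - (x' - x) / s|
      ≤ 2 * ε / |s| + (2 * |s| + 3 * ε) / g * (2 + 2 * ε / |s|) := by
  set w := sortedEigenvector hB with hw
  set p : n → ℝ := ∑ m, (if m ∈ J then v ⬝ᵥ w m else 0) • w m with hp
  set q : n → ℝ := ∑ m, (if m ∈ J then 0 else v ⬝ᵥ w m) • w m with hq
  have hpq : v = p + q := by
    conv_lhs => rw [← sum_sortedEigenvector hB v]
    rw [hp, hq, ← Finset.sum_add_distrib]
    refine Finset.sum_congr rfl fun m _ => ?_
    split_ifs <;> simp [hw]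
  have coef : ∀ (c : Fin (Fintype.card n) → ℝ) m, (∑ l, c l • w l) ⬝ᵥ w m = c m := by
    intro c m
    rw [sum_dotProduct]
    simp [smul_dotProduct, hw, sortedEigenvector_dotProduct]
  have hvn : euclNorm v = 1 := by
    have := euclNorm_sq v
    rw [hv] at this
    nlinarith [euclNorm_nonneg v]
  have hpn : euclNorm p ≤ 1 := by
    have h1 : euclNorm p ^ 2 ≤ euclNorm v ^ 2 := by
      rw [euclNorm_sq, euclNorm_sq, dotProduct_eq_sum hB, dotProduct_eq_sum hB v v]
      refine Finset.sum_le_sum fun m _ => ?_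
      rw [hp, coef]
      split_ifs
      · exact le_rfl
      · nlinarith [mul_self_nonneg (v ⬝ᵥ w m)]
    rw [hvn] at h1
    nlinarith [euclNorm_nonneg p]
  have hBp : euclNorm (B *ᵥ p - x' • p) ≤ ε := by
    have h1 : euclNorm (B *ᵥ p - x' • p) ^ 2 ≤ ε ^ 2 * euclNorm p ^ 2 := by
      rw [euclNorm_sq, euclNorm_sq, dotProduct_eq_sum hB, dotProduct_eq_sum hB p p, Finset.mul_sum]
      refine Finset.sum_le_sum fun m _ => ?_
      rw [sub_dotProduct, mulVec_dotProduct_sortedEigenvector, smul_dotProduct, smul_eq_mul,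
        ← sub_mul, hp, coef]
      split_ifs with hm
      · have := sq_le_sq' (abs_le.mp (hJ m hm)).1 (abs_le.mp (hJ m hm)).2
        nlinarith [mul_self_nonneg (v ⬝ᵥ w m)]
      · simp
    refine (pow_le_pow_iff_left₀ (euclNorm_nonneg _) hε two_ne_zero).mp ?_
    nlinarith [euclNorm_nonneg p, mul_nonneg (sq_nonneg ε) (sub_nonneg.mpr
      (pow_le_one₀ (n := 2) (euclNorm_nonneg p) hpn))]
  have hBv : B *ᵥ v - x' • v = (A *ᵥ v - x • v) + (s • (D *ᵥ v) + (x - x') • v) := by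
    rw [hBA, add_mulVec, smul_mulVec, sub_smul]; abel
  have hBvn : euclNorm (B *ᵥ v - x' • v) ≤ 2 * |s| + 3 * ε := by
    rw [hBv]
    refine (euclNorm_add_le _ _).trans ?_
    have h1 := euclNorm_add_le (s • (D *ᵥ v)) ((x - x') • v)
    rw [euclNorm_smul, euclNorm_smul, hvn] at h1
    have h2 := mul_le_mul_of_nonneg_left hD (abs_nonneg s)
    linarith
  have hqn : euclNorm q ≤ (2 * |s| + 3 * ε) / g := by
    have h1 : g ^ 2 * euclNorm q ^ 2 ≤ euclNorm (B *ᵥ v - x' • v) ^ 2 := by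
      rw [euclNorm_sq, euclNorm_sq, dotProduct_eq_sum hB, dotProduct_eq_sum hB (B *ᵥ v - x' • v),
        Finset.mul_sum]
      refine Finset.sum_le_sum fun m _ => ?_
      rw [sub_dotProduct, mulVec_dotProduct_sortedEigenvector, smul_dotProduct, smul_eq_mul,
        ← sub_mul, hq, coef]
      split_ifs with hm
      · simp only [mul_zero]; exact mul_self_nonneg _
      · have h3 : g ^ 2 ≤ (hB.eigenvalues₀ m - x') ^ 2 := by
          rw [← sq_abs (hB.eigenvalues₀ m - x')]
          exact pow_le_pow_left₀ hg.le (hJ' m hm) 2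
        have := mul_le_mul_of_nonneg_right h3 (mul_self_nonneg (v ⬝ᵥ w m))
        nlinarith
    rw [le_div_iff₀ hg]
    have h2 : g * euclNorm q ≤ euclNorm (B *ᵥ v - x' • v) := by
      refine (pow_le_pow_iff_left₀ (mul_nonneg hg.le (euclNorm_nonneg q)) (euclNorm_nonneg _)
        two_ne_zero).mp ?_
      rw [mul_pow]; exact h1
    linarith
  set c := (x' - x) / s with hc
  have hsp : 0 < |s| := abs_pos.mpr hs
  have hcn : |c| ≤ 1 + 2 * ε / |s| := by
    rw [hc, abs_div, abs_sub_comm, div_le_iff₀ hsp, add_mul, div_mul_cancel₀ _ hsp.ne']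
    linarith
  have hDc : euclNorm (D *ᵥ v - c • v) ≤ 2 + 2 * ε / |s| := by
    rw [sub_eq_add_neg, ← neg_smul]
    refine (euclNorm_add_le _ _).trans ?_
    rw [euclNorm_smul, hvn, abs_neg]
    linarith
  have hmain : s * (p ⬝ᵥ (D *ᵥ v - c • v)) = (B *ᵥ p - x' • p) ⬝ᵥ v - p ⬝ᵥ (A *ᵥ v - x • v) := by
    have h1 : (B *ᵥ p) ⬝ᵥ v = p ⬝ᵥ (A *ᵥ v) + s * (p ⬝ᵥ (D *ᵥ v)) := by
      rw [mulVec_dotProduct_comm hB, hBA, add_mulVec, smul_mulVec, dotProduct_add, dotProduct_smul,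
        smul_eq_mul]
    have h2 : s * c = x' - x := by rw [hc]; field_simp
    rw [dotProduct_sub, sub_dotProduct, dotProduct_sub, h1]
    simp only [dotProduct_smul, smul_dotProduct, smul_eq_mul]
    linear_combination (- (p ⬝ᵥ v)) * h2
  have hpD : |p ⬝ᵥ (D *ᵥ v - c • v)| ≤ 2 * ε / |s| := by
    rw [le_div_iff₀ hsp, ← abs_mul, mul_comm, hmain]
    refine (abs_sub _ _).trans ?_
    have h1 := abs_dotProduct_le (B *ᵥ p - x' • p) v
    have h2 := abs_dotProduct_le p (A *ᵥ v - x • v)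
    have h3 := mul_le_mul hpn hAv (euclNorm_nonneg _) zero_le_one
    rw [hvn] at h1
    linarith
  have hfin : v ⬝ᵥ (D *ᵥ v) - c = p ⬝ᵥ (D *ᵥ v - c • v) + q ⬝ᵥ (D *ᵥ v - c • v) := by
    rw [← add_dotProduct, ← hpq, dotProduct_sub, dotProduct_smul, hv]; simp
  rw [hfin]
  refine (abs_add_le _ _).trans (add_le_add hpD ((abs_dotProduct_le _ _).trans ?_))
  exact mul_le_mul hqn hDc (euclNorm_nonneg _) ((euclNorm_nonneg q).trans hqn)

end Spectral

section ProductMeasure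

variable {ι : Type*} [Fintype ι] [DecidableEq ι] {μ : Measure ℝ} [IsProbabilityMeasure μ]

/-- Fubini: a set whose sections in the direction `k` have measure at most `m`, contained in a
cylinder set over the remaining coordinates. -/
theorem pi_measureReal_le_of_sections (k : ι) {S G : Set (ι → ℝ)} (hS : MeasurableSet S)
    (hG : MeasurableSet G) (hSG : S ⊆ G) (hGk : ∀ x τ, x ∈ G → Function.update x k τ ∈ G)
    {m : ℝ} (hm : 0 ≤ m) (h : ∀ x, μ.real {τ | Function.update x k τ ∈ S} ≤ m) :
    (Measure.pi fun _ : ι => μ).real S ≤ m * (Measure.pi fun _ : ι => μ).real G := by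
  have hGk' : ∀ x τ, Function.update x k τ ∈ G ↔ x ∈ G := fun x τ =>
    ⟨fun hx => by simpa using hGk _ (x k) hx, hGk x τ⟩
  have key : ∫⁻ x, S.indicator 1 x ∂(Measure.pi fun _ : ι => μ)
      ≤ ∫⁻ x, G.indicator (fun _ => ENNReal.ofReal m) x ∂(Measure.pi fun _ : ι => μ) := by
    refine lintegral_le_of_lmarginal_le {k} (measurable_one.indicator hS)
      (measurable_const.indicator hG) ?_
    rw [lmarginal_singleton, lmarginal_singleton]
    intro x
    simp only
    have e1 : ∀ τ, S.indicator (1 : (ι → ℝ) → ENNReal) (Function.update x k τ)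
        = {τ | Function.update x k τ ∈ S}.indicator 1 τ := fun τ => rfl
    have hmeas : MeasurableSet {τ | Function.update x k τ ∈ S} :=
      (measurable_update x) hS
    simp only [e1]
    rw [lintegral_indicator_one hmeas]
    by_cases hx : x ∈ G
    · have e2 : ∀ τ, G.indicator (fun _ => ENNReal.ofReal m) (Function.update x k τ)
          = ENNReal.ofReal m := fun τ => Set.indicator_of_mem ((hGk' x τ).mpr hx) _
      simp only [e2, lintegral_const, measure_univ, mul_one]
      exact (ENNReal.le_ofReal_iff_toReal_le (measure_ne_top _ _) hm).mpr (h x)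
    · have : {τ | Function.update x k τ ∈ S} = ∅ := by
        ext τ
        simp only [Set.mem_ofPred_eq, Set.mem_empty_iff_false, iff_false]
        exact fun hτ => hx ((hGk' x τ).mp (hSG hτ))
      rw [this]; simp
  rw [lintegral_indicator_one hS, lintegral_indicator_const hG] at key
  have := ENNReal.toReal_mono (ENNReal.mul_ne_top ENNReal.ofReal_ne_top (measure_ne_top _ _)) key
  rwa [ENNReal.toReal_mul, ENNReal.toReal_ofReal hm] at this

theorem measureReal_le_of_diam {μ : Measure ℝ} {M : ℝ} (hM : 0 ≤ M)
    (hμ : ∀ T : Set ℝ, μ.real T ≤ M * volume.real (T ∩ Set.Icc 0 1)) {T : Set ℝ} {D : ℝ} (hD : 0 ≤ D)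
    (hT : ∀ x ∈ T, ∀ y ∈ T, |x - y| ≤ D) : μ.real T ≤ M * D := by
  refine (hμ T).trans (mul_le_mul_of_nonneg_left ?_ hM)
  refine ENNReal.toReal_le_of_le_ofReal hD ?_
  refine (measure_mono Set.inter_subset_left).trans ((Real.volume_le_diam T).trans ?_)
  refine Metric.ediam_le fun x hx y hy => ?_
  rw [edist_dist, Real.dist_eq]
  exact ENNReal.ofReal_le_ofReal (hT x hx y hy)

theorem measureReal_le_of_gap {μ : Measure ℝ} [IsFiniteMeasure μ] {M : ℝ} (hM : 0 ≤ M)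
    (hμ : ∀ T : Set ℝ, μ.real T ≤ M * volume.real (T ∩ Set.Icc 0 1)) {T : Set ℝ} {s₀ s₁ : ℝ}
    (hs₀ : 0 ≤ s₀) (hs₁ : 0 < s₁) (hs₁' : s₁ ≤ 1)
    (hT : ∀ x ∈ T, ∀ y ∈ T, |x - y| ≤ s₁ → |x - y| ≤ s₀) : μ.real T ≤ M * (2 * s₀ / s₁) := by
  set K := ⌊1 / s₁⌋₊ with hK
  have hKle : ((K + 1 : ℕ) : ℝ) ≤ 2 / s₁ := by
    have h1 := Nat.floor_le (by positivity : 0 ≤ 1 / s₁)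
    have h2 : 1 ≤ 1 / s₁ := by rw [le_div_iff₀ hs₁]; linarith
    push_cast
    calc (K : ℝ) + 1 ≤ 1 / s₁ + 1 / s₁ := add_le_add h1 h2
      _ = 2 / s₁ := by ring
  have hcov : T ⊆ (T \ Set.Icc 0 1) ∪ ⋃ m ∈ Finset.range (K + 1),
      T ∩ Set.Icc (m * s₁) (m * s₁ + s₁) := by
    intro x hx
    by_cases hx1 : x ∈ Set.Icc (0 : ℝ) 1
    · right
      simp only [Set.mem_iUnion]
      refine ⟨⌊x / s₁⌋₊, ?_, hx, ?_, ?_⟩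
      · rw [Finset.mem_range, Nat.lt_succ_iff]
        exact Nat.floor_mono (div_le_div_of_nonneg_right hx1.2 hs₁.le)
      · have h1 := Nat.floor_le (div_nonneg hx1.1 hs₁.le)
        rwa [le_div_iff₀ hs₁] at h1
      · have h1 := (Nat.lt_floor_add_one (x / s₁)).le
        rw [div_le_iff₀ hs₁] at h1
        linarith
    · left; exact ⟨hx, hx1⟩
  have h0 : μ.real (T \ Set.Icc 0 1) ≤ 0 := by
    refine (hμ _).trans ?_
    rw [Set.sdiff_inter_self]; simp
  have h1 : ∀ m ∈ Finset.range (K + 1), μ.real (T ∩ Set.Icc (m * s₁) (m * s₁ + s₁)) ≤ M * s₀ := by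
    intro m _
    refine measureReal_le_of_diam hM hμ hs₀ fun x hx y hy => hT x hx.1 y hy.1 ?_
    rw [abs_le]
    constructor <;> linarith [hx.2.1, hx.2.2, hy.2.1, hy.2.2]
  calc μ.real T ≤ _ := measureReal_mono hcov
    _ ≤ _ := measureReal_union_le _ _
    _ ≤ 0 + ∑ m ∈ Finset.range (K + 1), M * s₀ :=
        add_le_add h0 ((measureReal_biUnion_finset_le _ _).trans (Finset.sum_le_sum h1))
    _ = M * (((K + 1 : ℕ) : ℝ) * s₀) := by simp; ring
    _ ≤ M * (2 / s₁ * s₀) := by gcongr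
    _ = _ := by ring

end ProductMeasure

section BlockModel

variable {n ι : Type*} [DecidableEq n]

/-- A matrix with a block potential: the potential at the site `s` is `x (blk s)`. -/
def blockModel (A₀ : Matrix n n ℝ) (blk : n → ι) (x : ι → ℝ) : Matrix n n ℝ :=
  A₀ + diagonal (x ∘ blk)

theorem isHermitian_blockModel {A₀ : Matrix n n ℝ} (hA₀ : A₀.IsHermitian) (blk : n → ι)
    (x : ι → ℝ) : (blockModel A₀ blk x).IsHermitian :=
  hA₀.add (isHermitian_diagonal _)

theorem blockModel_update [DecidableEq ι] {A₀ : Matrix n n ℝ} (blk : n → ι) (x : ι → ℝ) (k : ι) (s : ℝ) :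
    blockModel A₀ blk (Function.update x k (x k + s))
      = blockModel A₀ blk x + s • diagonal fun a => if blk a = k then (1 : ℝ) else 0 := by
  rw [blockModel, blockModel, add_assoc]
  congr 1
  rw [← diagonal_smul, diagonal_add]
  congr 1
  ext a
  by_cases h : blk a = k
  · subst h; simp
  · simp [h]

end BlockModel

section Model

variable {n ι : Type*} [Fintype n] [DecidableEq n]

/-- The eigenvalues of the block model in decreasing order. -/
def level {A₀ : Matrix n n ℝ} (hA₀ : A₀.IsHermitian) (blk : n → ι) (i : Fin (Fintype.card n))
    (x : ι → ℝ) : ℝ :=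
  (isHermitian_blockModel hA₀ blk x).eigenvalues₀ i

variable {A₀ : Matrix n n ℝ} (hA₀ : A₀.IsHermitian) (blk : n → ι)

theorem form_blockModel (x : ι → ℝ) (v : n → ℝ) :
    v ⬝ᵥ (blockModel A₀ blk x *ᵥ v) = v ⬝ᵥ (A₀ *ᵥ v) + ∑ s, x (blk s) * v s ^ 2 := by
  rw [blockModel, add_mulVec, dotProduct_add]
  congr 1
  simp only [dotProduct, mulVec_diagonal, Function.comp]
  exact Finset.sum_congr rfl fun s _ => by ring

theorem level_le_of_le {x y : ι → ℝ} {t : ℝ} (h : ∀ k, x k ≤ y k + t) (i : Fin (Fintype.card n)) :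
    level hA₀ blk i x ≤ level hA₀ blk i y + t := by
  refine eigenvalues₀_le_of_form_le _ _ ∅ t (fun v _ => ?_) i i (by simp)
  rw [form_blockModel, form_blockModel, add_assoc]
  refine add_le_add_right ?_ _
  rw [dotProduct, Finset.mul_sum, ← Finset.sum_add_distrib]
  refine Finset.sum_le_sum fun s _ => ?_
  nlinarith [h (blk s), mul_self_nonneg (v s)]

theorem level_mono {x y : ι → ℝ} (h : ∀ k, x k ≤ y k) (i : Fin (Fintype.card n)) :
    level hA₀ blk i x ≤ level hA₀ blk i y := by
  simpa using level_le_of_le hA₀ blk (t := 0) (by simpa using h) i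

theorem level_antitone {i j : Fin (Fintype.card n)} (h : i ≤ j) (x : ι → ℝ) :
    level hA₀ blk j x ≤ level hA₀ blk i x :=
  (isHermitian_blockModel hA₀ blk x).eigenvalues₀_antitone h

theorem abs_level_sub_le {x y : ι → ℝ} {t : ℝ} (h : ∀ k, |x k - y k| ≤ t)
    (i : Fin (Fintype.card n)) : |level hA₀ blk i x - level hA₀ blk i y| ≤ t := by
  rw [abs_le]
  have h1 := level_le_of_le hA₀ blk (x := x) (y := y) (t := t)
    (fun k => by linarith [(abs_le.mp (h k)).2]) i
  have h2 := level_le_of_le hA₀ blk (x := y) (y := x) (t := t)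
    (fun k => by linarith [(abs_le.mp (h k)).1]) i
  constructor <;> linarith

theorem continuous_level [Fintype ι] (i : Fin (Fintype.card n)) :
    Continuous (level hA₀ blk i) := by
  refine LipschitzWith.continuous (K := 1) (LipschitzWith.of_dist_le_mul fun x y => ?_)
  rw [NNReal.coe_one, one_mul, Real.dist_eq]
  exact abs_level_sub_le hA₀ blk (fun k => by rw [← Real.dist_eq]; exact dist_le_pi_dist x y k) i

/-- Interlacing: changing one coupling moves the eigenvalues by at most `R` positions. -/
theorem level_update_le [DecidableEq ι] {R : ℕ}
    (hR : ∀ k, (Finset.univ.filter fun s => blk s = k).card ≤ R) (x : ι → ℝ) (k : ι) (τ : ℝ)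
    {i j : Fin (Fintype.card n)} (hij : (i : ℕ) + R ≤ j) :
    level hA₀ blk j (Function.update x k τ) ≤ level hA₀ blk i x := by
  have := eigenvalues₀_le_of_form_le (isHermitian_blockModel hA₀ blk (Function.update x k τ))
    (isHermitian_blockModel hA₀ blk x) (Finset.univ.filter fun s => blk s = k) 0 (fun v hv => ?_) i j
    (by have := hR k; omega)
  · rw [add_zero] at this; exact this
  rw [form_blockModel, form_blockModel, zero_mul, add_zero]
  refine add_le_add_right (le_of_eq (Finset.sum_congr rfl fun s _ => ?_)) _
  by_cases hs : blk s = k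
  · rw [hv s (by simp [hs])]; simp
  · rw [Function.update_of_ne hs]

theorem le_level_update [DecidableEq ι] {R : ℕ}
    (hR : ∀ k, (Finset.univ.filter fun s => blk s = k).card ≤ R) (x : ι → ℝ) (k : ι) (τ : ℝ)
    {i j : Fin (Fintype.card n)} (hij : (i : ℕ) + R ≤ j) :
    level hA₀ blk j x ≤ level hA₀ blk i (Function.update x k τ) := by
  simpa using level_update_le hA₀ blk hR (Function.update x k τ) k (x k) hij

end Model

section Wegner

variable {n ι : Type*} [Fintype n] [DecidableEq n] [Fintype ι]
  {A₀ : Matrix n n ℝ} (hA₀ : A₀.IsHermitian) (blk : n → ι)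

/-- The couplings with the first `m` of them raised by `t`. -/
def raise (t : ℝ) (m : ℕ) (x : ι → ℝ) : ι → ℝ := fun l =>
  x l + if (Fintype.equivFin ι l : ℕ) < m then t else 0

theorem continuous_raise (t : ℝ) (m : ℕ) : Continuous (raise (ι := ι) t m) := by
  unfold raise; fun_prop

/-- The couplings for which raising the coupling `k`, after the previous ones, lifts the `i`-th
eigenvalue over `b`. -/
def crossing (i : Fin (Fintype.card n)) (b t : ℝ) (k : ι) : Set (ι → ℝ) :=
  {x | level hA₀ blk i (raise t (Fintype.equivFin ι k) x) ≤ b} ∩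
    {x | b < level hA₀ blk i (raise t (Fintype.equivFin ι k + 1) x)}

theorem measurableSet_crossing (i : Fin (Fintype.card n)) (b t : ℝ) (k : ι) :
    MeasurableSet (crossing hA₀ blk i b t k) := by
  refine MeasurableSet.inter (IsClosed.measurableSet ?_) (IsOpen.measurableSet ?_)
  · exact isClosed_le ((continuous_level hA₀ blk i).comp (continuous_raise t _)) continuous_const
  · exact isOpen_lt continuous_const ((continuous_level hA₀ blk i).comp (continuous_raise t _))

theorem exists_mem_crossing {i : Fin (Fintype.card n)} {b t : ℝ} (ht : 0 < t) {x : ι → ℝ}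
    (hx : level hA₀ blk i x ∈ Set.Icc (b - t) b) : ∃ k, x ∈ crossing hA₀ blk i b (2 * t) k := by
  classical
  have h0 : raise (2 * t) 0 x = x := by ext l; simp [raise]
  have hN : b < level hA₀ blk i (raise (2 * t) (Fintype.card ι) x) := by
    have := level_le_of_le hA₀ blk (x := x) (y := raise (2 * t) (Fintype.card ι) x) (t := - (2 * t))
      (fun k => by simp [raise]) i
    linarith [hx.1]
  have hex : ∃ m, b < level hA₀ blk i (raise (2 * t) m x) := ⟨_, hN⟩
  set m := Nat.find hex with hm
  have hm1 : b < level hA₀ blk i (raise (2 * t) m x) := Nat.find_spec hex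
  have hm0 : m ≠ 0 := by
    intro h
    rw [h, h0] at hm1
    exact absurd hx.2 (not_le.mpr hm1)
  obtain ⟨m', hm'⟩ := Nat.exists_eq_succ_of_ne_zero hm0
  have hm2 : level hA₀ blk i (raise (2 * t) m' x) ≤ b :=
    not_lt.mp (Nat.find_min hex (by omega))
  have hcard : m ≤ Fintype.card ι := Nat.find_min' hex hN
  have hlt : m' < Fintype.card ι := by omega
  refine ⟨(Fintype.equivFin ι).symm ⟨m', hlt⟩, ?_, ?_⟩
  · simpa using hm2
  · simpa [hm'] using hm1

theorem abs_sub_le_of_mem_crossing [DecidableEq ι] {i : Fin (Fintype.card n)} {b t : ℝ} {k : ι}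
    {x : ι → ℝ}
    {τ τ' : ℝ} (h : Function.update x k τ ∈ crossing hA₀ blk i b t k)
    (h' : Function.update x k τ' ∈ crossing hA₀ blk i b t k) : |τ - τ'| ≤ t := by
  wlog hle : τ ≤ τ' generalizing τ τ'
  · rw [abs_sub_comm]; exact this h' h (le_of_not_ge hle)
  rw [abs_sub_comm, abs_of_nonneg (by linarith)]
  by_contra hlt
  push Not at hlt
  have : level hA₀ blk i (raise t (Fintype.equivFin ι k + 1) (Function.update x k τ))
      ≤ level hA₀ blk i (raise t (Fintype.equivFin ι k) (Function.update x k τ')) := by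
    refine level_mono hA₀ blk (fun l => ?_) i
    by_cases hl : l = k
    · subst hl; simp [raise]; linarith
    · have hne : (Fintype.equivFin ι l : ℕ) ≠ Fintype.equivFin ι k := fun e =>
        hl ((Fintype.equivFin ι).injective (Fin.ext e))
      have hiff : (Fintype.equivFin ι l : ℕ) < Fintype.equivFin ι k + 1
          ↔ (Fintype.equivFin ι l : ℕ) < Fintype.equivFin ι k := by omega
      simp [raise, Function.update_of_ne hl, hiff]
  exact absurd (h.2.trans_le this) (not_lt.mpr h'.1)

variable [DecidableEq ι] {μ : Measure ℝ} [IsProbabilityMeasure μ] {M : ℝ}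

theorem measureReal_crossing_inter_le (hM : 0 ≤ M)
    (hμ : ∀ T : Set ℝ, μ.real T ≤ M * volume.real (T ∩ Set.Icc 0 1))
    (i : Fin (Fintype.card n)) (b : ℝ) {t : ℝ} (ht : 0 ≤ t) (k : ι) {G : Set (ι → ℝ)}
    (hG : MeasurableSet G) (hGk : ∀ x τ, x ∈ G → Function.update x k τ ∈ G) :
    (Measure.pi fun _ : ι => μ).real (crossing hA₀ blk i b t k ∩ G)
      ≤ M * t * (Measure.pi fun _ : ι => μ).real G := by
  refine pi_measureReal_le_of_sections k ((measurableSet_crossing hA₀ blk i b t k).inter hG) hG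
    Set.inter_subset_right hGk (mul_nonneg hM ht) fun x => ?_
  exact measureReal_le_of_diam hM hμ ht fun τ h τ' h' =>
    abs_sub_le_of_mem_crossing hA₀ blk h.1 h'.1

/-- Wegner estimate for a single eigenvalue. -/
theorem wegner (hM : 0 ≤ M) (hμ : ∀ T : Set ℝ, μ.real T ≤ M * volume.real (T ∩ Set.Icc 0 1))
    (i : Fin (Fintype.card n)) (b : ℝ) {t : ℝ} (ht : 0 < t) :
    (Measure.pi fun _ : ι => μ).real {x | level hA₀ blk i x ∈ Set.Icc (b - t) b}
      ≤ Fintype.card ι * (M * (2 * t)) := by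
  have hsub : {x | level hA₀ blk i x ∈ Set.Icc (b - t) b}
      ⊆ ⋃ k : ι, crossing hA₀ blk i b (2 * t) k ∩ Set.univ := by
    intro x hx
    obtain ⟨k, hk⟩ := exists_mem_crossing hA₀ blk ht hx
    exact Set.mem_iUnion.mpr ⟨k, hk, trivial⟩
  refine (measureReal_mono hsub).trans ((measureReal_iUnion_fintype_le _).trans ?_)
  refine (Finset.sum_le_card_nsmul _ _ (M * (2 * t)) fun k _ => ?_).trans (by simp)
  refine (measureReal_crossing_inter_le hA₀ blk hM hμ i b (by positivity) k MeasurableSet.univ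
    fun _ _ _ => trivial).trans ?_
  simp

/-- Minami-type estimate: two eigenvalues whose positions differ by at least the rank `R` of the
single-site potentials are rarely in the same small interval. -/
theorem minami {R : ℕ} (hR : ∀ k, (Finset.univ.filter fun s => blk s = k).card ≤ R) (hM : 0 ≤ M)
    (hμ : ∀ T : Set ℝ, μ.real T ≤ M * volume.real (T ∩ Set.Icc 0 1))
    {i j : Fin (Fintype.card n)} (hij : (i : ℕ) + R ≤ j) (b : ℝ) {t : ℝ} (ht : 0 < t) :
    (Measure.pi fun _ : ι => μ).real {x | level hA₀ blk i x ∈ Set.Icc (b - t) b ∧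
        level hA₀ blk j x ∈ Set.Icc (b - t) b}
      ≤ 2 * (Fintype.card ι * (M * (2 * t))) ^ 2 := by
  set W := Set.Icc (b - t) b with hW
  set V : Set (ι → ℝ) := {x | level hA₀ blk i x ∈ W} ∪ {x | level hA₀ blk j x ∈ W} with hV
  have hVc : IsClosed V := by
    refine IsClosed.union ?_ ?_
    · exact isClosed_Icc.preimage (continuous_level hA₀ blk i)
    · exact isClosed_Icc.preimage (continuous_level hA₀ blk j)
  set G : ι → Set (ι → ℝ) := fun k => {x | ∀ τ, Function.update x k τ ∈ V} with hG
  have hGc : ∀ k, MeasurableSet (G k) := by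
    intro k
    refine IsClosed.measurableSet ?_
    have : G k = ⋂ τ, (fun x => Function.update x k τ) ⁻¹' V := by ext x; simp [hG]
    rw [this]
    exact isClosed_iInter fun τ => hVc.preimage (continuous_id.update k continuous_const)
  have hGV : ∀ k, G k ⊆ V := fun k x hx => by simpa using hx (x k)
  have hVm : (Measure.pi fun _ : ι => μ).real V ≤ 2 * (Fintype.card ι * (M * (2 * t))) := by
    refine (measureReal_union_le _ _).trans ?_
    have h1 := wegner hA₀ blk hM hμ i b ht
    have h2 := wegner hA₀ blk hM hμ j b ht
    linarith
  have hsub : {x | level hA₀ blk i x ∈ W ∧ level hA₀ blk j x ∈ W}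
      ⊆ ⋃ k : ι, crossing hA₀ blk i b (2 * t) k ∩ G k := by
    rintro x ⟨hxi, hxj⟩
    obtain ⟨k, hk⟩ := exists_mem_crossing hA₀ blk ht hxi
    refine Set.mem_iUnion.mpr ⟨k, hk, fun τ => ?_⟩
    have h1 := level_update_le hA₀ blk hR x k τ hij
    have h2 := le_level_update hA₀ blk hR x k τ hij
    rcases le_total (x k) τ with h | h
    · right
      refine ⟨hxj.1.trans (level_mono hA₀ blk (fun l => ?_) j), h1.trans hxi.2⟩
      by_cases hl : l = k
      · subst hl; simpa using h
      · simp [Function.update_of_ne hl]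
    · left
      refine ⟨hxj.1.trans h2, (level_mono hA₀ blk (fun l => ?_) i).trans hxi.2⟩
      by_cases hl : l = k
      · subst hl; simpa using h
      · simp [Function.update_of_ne hl]
  refine (measureReal_mono hsub).trans ((measureReal_iUnion_fintype_le _).trans ?_)
  refine (Finset.sum_le_card_nsmul _ _
    (M * (2 * t) * (2 * (Fintype.card ι * (M * (2 * t))))) fun k _ => ?_).trans ?_
  · refine (measureReal_crossing_inter_le hA₀ blk hM hμ i b (by positivity) k (hGc k)
      fun x τ hx τ' => by simpa using hx τ').trans ?_
    exact mul_le_mul_of_nonneg_left ((measureReal_mono (hGV k)).trans hVm) (by positivity)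
  · rw [Finset.card_univ, nsmul_eq_mul]
    exact le_of_eq (by ring)

end Wegner

section Cluster

variable {n ι : Type*} [Fintype n] [DecidableEq n]
  {A₀ : Matrix n n ℝ} (hA₀ : A₀.IsHermitian) (blk : n → ι)

/-- The couplings for which the eigenvalues with indices in `J` are within `ε` of the `i`-th one, and
all others are at distance at least `g` from it. -/
def isolated (i : Fin (Fintype.card n)) (J : Finset (Fin (Fintype.card n))) (ε g : ℝ) :
    Set (ι → ℝ) :=
  {x | (∀ l ∈ J, |level hA₀ blk l x - level hA₀ blk i x| ≤ ε) ∧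
    ∀ l ∉ J, g ≤ |level hA₀ blk l x - level hA₀ blk i x|}

theorem isClosed_isolated [Fintype ι] (i : Fin (Fintype.card n))
    (J : Finset (Fin (Fintype.card n))) (ε g : ℝ) : IsClosed (isolated hA₀ blk i J ε g) := by
  have hc := continuous_level hA₀ blk
  have : isolated hA₀ blk i J ε g = (⋂ l ∈ J, {x | |level hA₀ blk l x - level hA₀ blk i x| ≤ ε}) ∩
      ⋂ l ∈ Jᶜ, {x | g ≤ |level hA₀ blk l x - level hA₀ blk i x|} := by
    ext x; simp [isolated]
  rw [this]
  refine IsClosed.inter ?_ ?_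
  · exact isClosed_biInter fun l _ => isClosed_le ((hc l).sub (hc i)).abs continuous_const
  · exact isClosed_biInter fun l _ => isClosed_le continuous_const ((hc l).sub (hc i)).abs

variable [DecidableEq ι]

/-- The couplings with an isolated cluster, two eigenvalues of which are in `I`, that is broken up
by every change of the coupling `k` of a size between `s₀` and `s₁`. -/
def breakable (i j : Fin (Fintype.card n)) (J : Finset (Fin (Fintype.card n))) (ε g s₀ s₁ : ℝ)
    (I : Set ℝ) (k : ι) : Set (ι → ℝ) :=
  (isolated hA₀ blk i J ε g ∩ {x | level hA₀ blk i x ∈ I ∧ level hA₀ blk j x ∈ I}) \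
    {x | ∃ s : ℝ, s₀ ≤ |s| ∧ |s| ≤ s₁ ∧ Function.update x k (x k + s) ∈ isolated hA₀ blk i J ε g}

theorem measurableSet_breakable [Fintype ι] (i j : Fin (Fintype.card n))
    (J : Finset (Fin (Fintype.card n))) (ε g s₀ s₁ : ℝ) {I : Set ℝ} (hI : IsClosed I) (k : ι) :
    MeasurableSet (breakable hA₀ blk i j J ε g s₀ s₁ I k) := by
  have hK := isClosed_isolated hA₀ blk i J ε g
  refine MeasurableSet.diff (IsClosed.measurableSet ?_) (IsClosed.measurableSet ?_)
  · exact hK.inter ((hI.preimage (continuous_level hA₀ blk i)).inter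
      (hI.preimage (continuous_level hA₀ blk j)))
  · set T : Set ℝ := Set.Icc (-s₁) s₁ ∩ {s | s₀ ≤ |s|} with hT
    have hTc : IsCompact T := isCompact_Icc.inter_right
      (isClosed_le continuous_const continuous_abs)
    have : CompactSpace T := isCompact_iff_compactSpace.mp hTc
    have hcl : IsClosed {q : (ι → ℝ) × T |
        Function.update q.1 k (q.1 k + q.2) ∈ isolated hA₀ blk i J ε g} := by
      refine hK.preimage (continuous_fst.update k ?_)
      fun_prop
    have := isClosedMap_fst_of_compactSpace _ hcl
    convert this using 1
    ext x
    constructor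
    · rintro ⟨s, h0, h1, h2⟩
      exact ⟨(x, ⟨s, abs_le.mp h1, h0⟩), h2, rfl⟩
    · rintro ⟨⟨y, s⟩, h, rfl⟩
      exact ⟨s, s.2.2, abs_le.mpr s.2.1, h⟩

theorem measureReal_breakable_le [Fintype ι] {μ : Measure ℝ} [IsProbabilityMeasure μ] {M : ℝ}
    (hM : 0 ≤ M) (hμ : ∀ T : Set ℝ, μ.real T ≤ M * volume.real (T ∩ Set.Icc 0 1))
    (i j : Fin (Fintype.card n)) (J : Finset (Fin (Fintype.card n))) (ε g : ℝ) {s₀ s₁ : ℝ}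
    (hs₀ : 0 ≤ s₀) (hs₁ : 0 < s₁) (hs₁' : s₁ ≤ 1) {I : Set ℝ} (hI : IsClosed I) (k : ι) :
    (Measure.pi fun _ : ι => μ).real (breakable hA₀ blk i j J ε g s₀ s₁ I k)
      ≤ M * (2 * s₀ / s₁) := by
  have := pi_measureReal_le_of_sections (μ := μ) k
    (measurableSet_breakable hA₀ blk i j J ε g s₀ s₁ hI k) MeasurableSet.univ (Set.subset_univ _)
    (fun _ _ _ => trivial) (m := M * (2 * s₀ / s₁)) (by positivity) fun x => ?_
  · simpa using this
  refine measureReal_le_of_gap hM hμ hs₀ hs₁ hs₁' fun τ h τ' h' hle => ?_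
  by_contra hlt
  push Not at hlt
  refine h.2 ⟨τ' - τ, ?_, ?_, ?_⟩
  · rw [abs_sub_comm]; exact hlt.le
  · rwa [abs_sub_comm]
  · simpa using h'.1.1

/-- The single-site potentials are not all close to scalars on the span of two eigenvectors with
eigenvalues in `I`. -/
def NonScalar (η : ℝ) (I : Set ℝ) : Prop :=
  ∀ x : ι → ℝ, (∀ k, x k ∈ Set.Icc (0 : ℝ) 1) → ∀ i j : Fin (Fintype.card n), i ≠ j →
    level hA₀ blk i x ∈ I → level hA₀ blk j x ∈ I → ∃ k : ι, ∀ c : ℝ, ∃ α β : ℝ,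
      α ^ 2 + β ^ 2 = 1 ∧ η < |(∑ s, if blk s = k then
        (α * sortedEigenvector (isHermitian_blockModel hA₀ blk x) i s
          + β * sortedEigenvector (isHermitian_blockModel hA₀ blk x) j s) ^ 2 else 0) - c|

theorem exists_mem_breakable {η : ℝ} {I : Set ℝ} (hη : 0 < η) (hη' : η ≤ 1)
    (hNS : NonScalar hA₀ blk η I) {ε g : ℝ} (hε : 0 < ε) (hg : 0 < g)
    {i j : Fin (Fintype.card n)} (hij : i ≠ j) {J : Finset (Fin (Fintype.card n))} (hj : j ∈ J)
    {x : ι → ℝ} (hx : ∀ k, x k ∈ Set.Icc (0 : ℝ) 1) (hxJ : x ∈ isolated hA₀ blk i J ε g)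
    (hiI : level hA₀ blk i x ∈ I) (hjI : level hA₀ blk j x ∈ I) :
    ∃ k, x ∈ breakable hA₀ blk i j J ε g (8 * ε / η) (g * η / 36) I k := by
  obtain ⟨k, hk⟩ := hNS x hx i j hij hiI hjI
  refine ⟨k, ⟨hxJ, hiI, hjI⟩, ?_⟩
  rintro ⟨s, hs0, hs1, hs⟩
  have hspos : 0 < |s| := lt_of_lt_of_le (by positivity) hs0
  have hs' : s ≠ 0 := abs_pos.mp hspos
  set y := Function.update x k (x k + s) with hy
  obtain ⟨α, β, hαβ, hlt⟩ := hk ((level hA₀ blk i y - level hA₀ blk i x) / s)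
  set hA := isHermitian_blockModel hA₀ blk x
  set hB := isHermitian_blockModel hA₀ blk y
  set v : n → ℝ := α • sortedEigenvector hA i + β • sortedEigenvector hA j with hv
  set D : Matrix n n ℝ := diagonal fun a => if blk a = k then (1 : ℝ) else 0 with hD
  have hvv : v ⬝ᵥ v = 1 := by
    rw [hv]
    simp only [add_dotProduct, dotProduct_add, smul_dotProduct, dotProduct_smul,
      sortedEigenvector_dotProduct, if_neg hij, if_neg hij.symm, smul_eq_mul, if_true]
    linarith
  have hAv : blockModel A₀ blk x *ᵥ v - level hA₀ blk i x • v
      = (β * (level hA₀ blk j x - level hA₀ blk i x)) • sortedEigenvector hA j := by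
    rw [hv, mulVec_add, mulVec_smul, mulVec_smul, mulVec_sortedEigenvector hA,
      mulVec_sortedEigenvector hA]
    ext a
    simp only [Pi.add_apply, Pi.sub_apply, Pi.smul_apply, smul_eq_mul, level]
    ring
  have hβ : |β| ≤ 1 := by
    rw [← sq_le_one_iff_abs_le_one]; nlinarith
  have hnj : euclNorm (sortedEigenvector hA j) = 1 := by
    have h1 := euclNorm_sq (sortedEigenvector hA j)
    rw [sortedEigenvector_dotProduct, if_pos rfl] at h1
    nlinarith [euclNorm_nonneg (sortedEigenvector hA j)]
  have hAvn : euclNorm (blockModel A₀ blk x *ᵥ v - level hA₀ blk i x • v) ≤ ε := by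
    rw [hAv, euclNorm_smul, hnj, mul_one, abs_mul]
    calc |β| * |level hA₀ blk j x - level hA₀ blk i x| ≤ 1 * ε :=
          mul_le_mul hβ (hxJ.1 j hj) (abs_nonneg _) zero_le_one
      _ = ε := one_mul _
  have hDv : v ⬝ᵥ (D *ᵥ v) = ∑ a, if blk a = k then v a ^ 2 else 0 := by
    simp only [dotProduct, hD, mulVec_diagonal]
    refine Finset.sum_congr rfl fun a _ => ?_
    split_ifs <;> ring
  have hDn : euclNorm (D *ᵥ v) ≤ 1 := by
    have h1 : euclNorm (D *ᵥ v) ^ 2 ≤ 1 := by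
      rw [euclNorm_sq, ← hvv]
      simp only [dotProduct, hD, mulVec_diagonal]
      refine Finset.sum_le_sum fun a _ => ?_
      split_ifs
      · simp
      · simp [mul_self_nonneg]
    nlinarith [euclNorm_nonneg (D *ᵥ v)]
  have hshift : |level hA₀ blk i x - level hA₀ blk i y| ≤ |s| + 2 * ε := by
    have := abs_level_sub_le hA₀ blk (x := x) (y := y) (t := |s|) (fun l => ?_) i
    · linarith
    by_cases hl : l = k
    · subst hl; simp [hy]
    · simp [hy, Function.update_of_ne hl]
  have hfin := abs_form_sub_le hB (D := D) (s := s) (x := level hA₀ blk i x)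
    (x' := level hA₀ blk i y) (ε := ε) (g := g) (blockModel_update blk x k s) hs' hg hε.le
    (J : Set (Fin (Fintype.card n))) (fun m hm => hs.1 m hm) (fun m hm => hs.2 m hm) v hvv hAvn hDn
    hshift
  rw [hDv] at hfin
  have hlt' : η < 2 * ε / |s| + (2 * |s| + 3 * ε) / g * (2 + 2 * ε / |s|) := by
    refine hlt.trans_le (le_trans (le_of_eq ?_) hfin)
    simp only [hv, Pi.add_apply, Pi.smul_apply, smul_eq_mul]
  have h8 : 8 * ε ≤ |s| * η := by rwa [div_le_iff₀ hη] at hs0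
  have e1 : 2 * ε / |s| ≤ η / 4 := by
    rw [div_le_iff₀ hspos]; linarith
  have e2 : (2 * |s| + 3 * ε) / g ≤ η / 12 := by
    rw [div_le_iff₀ hg]; nlinarith
  have e3 : (2 * |s| + 3 * ε) / g * (2 + 2 * ε / |s|) ≤ η / 12 * 3 := by
    refine mul_le_mul e2 (by linarith) (by positivity) (by positivity)
  linarith

end Cluster

theorem exists_succ_eq_of_card_le {α : Type*} {R : ℕ} (J : ℕ → Finset α)
    (hJ : ∀ m, J (m + 1) ⊆ J m) (h0 : (J 0).card ≤ R) (hR : 2 ≤ (J R).card) :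
    ∃ m < R, J (m + 1) = J m := by
  by_contra hne
  push Not at hne
  have hlt : ∀ m < R, (J (m + 1)).card < (J m).card := fun m hm =>
    Finset.card_lt_card ((hJ m).ssubset_of_ne (hne m hm))
  have : ∀ m ≤ R, (J m).card + m ≤ R := by
    intro m
    induction m with
    | zero => intro _; simpa using h0
    | succ m ih =>
      intro hm
      have := ih (by omega)
      have := hlt m (by omega)
      omega
  have := this R le_rfl
  omega

section Spacing

variable {n ι : Type*} [Fintype n] [DecidableEq n]
  {A₀ : Matrix n n ℝ} (hA₀ : A₀.IsHermitian) (blk : n → ι)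

/-- The eigenvalues within distance `ε` of the `i`-th one. -/
def nearby (x : ι → ℝ) (i : Fin (Fintype.card n)) (ε : ℝ) : Finset (Fin (Fintype.card n)) :=
  Finset.univ.filter fun l => |level hA₀ blk l x - level hA₀ blk i x| ≤ ε

theorem mem_nearby {x : ι → ℝ} {i l : Fin (Fintype.card n)} {ε : ℝ} :
    l ∈ nearby hA₀ blk x i ε ↔ |level hA₀ blk l x - level hA₀ blk i x| ≤ ε := by
  simp [nearby]

theorem exists_nearby_eq_Icc (x : ι → ℝ) (i : Fin (Fintype.card n)) {ε : ℝ} (hε : 0 ≤ ε) :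
    ∃ a c, nearby hA₀ blk x i ε = Finset.Icc a c := by
  have hne : (nearby hA₀ blk x i ε).Nonempty := ⟨i, by simpa [nearby] using hε⟩
  refine ⟨(nearby hA₀ blk x i ε).min' hne, (nearby hA₀ blk x i ε).max' hne, ?_⟩
  ext l
  rw [Finset.mem_Icc]
  refine ⟨fun h => ⟨Finset.min'_le _ _ h, Finset.le_max' _ _ h⟩, fun ⟨h1, h2⟩ => ?_⟩
  have ha := Finset.min'_mem _ hne
  have hc := Finset.max'_mem _ hne
  rw [mem_nearby, abs_le] at ha hc ⊢
  have h3 := level_antitone hA₀ blk h1 x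
  have h4 := level_antitone hA₀ blk h2 x
  constructor <;> linarith

/-- Two close eigenvalues belong to a cluster of more than `R` eigenvalues, or to an isolated
cluster on one of the `R` scales `θ ^ (m + 1)`. -/
theorem exists_cluster {R : ℕ} {θ : ℝ} (hθ : 0 < θ) (hθ' : θ ≤ 1) (x : ι → ℝ)
    {i j : Fin (Fintype.card n)} (hij : i ≠ j)
    (h : |level hA₀ blk i x - level hA₀ blk j x| ≤ θ ^ (R + 1)) :
    (∃ l l' : Fin (Fintype.card n), (l : ℕ) + R ≤ l' ∧
      |level hA₀ blk l x - level hA₀ blk i x| ≤ θ ∧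
      |level hA₀ blk l' x - level hA₀ blk i x| ≤ θ) ∨
    ∃ m < R, ∃ a c, j ∈ Finset.Icc a c ∧
      x ∈ isolated hA₀ blk i (Finset.Icc a c) (θ ^ (m + 2)) (θ ^ (m + 1)) := by
  set J : ℕ → Finset (Fin (Fintype.card n)) := fun m => nearby hA₀ blk x i (θ ^ (m + 1)) with hJ
  have hmem : ∀ m l, l ∈ J m ↔ |level hA₀ blk l x - level hA₀ blk i x| ≤ θ ^ (m + 1) := by
    intro m l; exact mem_nearby hA₀ blk
  have hi : ∀ m, i ∈ J m := fun m => by rw [hmem]; simp; positivity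
  have hjR : j ∈ J R := by rw [hmem, abs_sub_comm]; exact h
  have hanti : ∀ m m', m ≤ m' → J m' ⊆ J m := fun m m' hm l hl => by
    rw [hmem] at hl ⊢
    exact hl.trans (pow_le_pow_of_le_one hθ.le hθ' (by omega))
  rcases Nat.lt_or_ge R (J 0).card with hcard | hcard
  · left
    obtain ⟨a, c, hac⟩ := exists_nearby_eq_Icc hA₀ blk x i (ε := θ ^ (0 + 1)) (by positivity)
    have hac' : J 0 = Finset.Icc a c := hac
    have hle : a ≤ c := by
      have := hi 0
      rw [hac', Finset.mem_Icc] at this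
      exact this.1.trans this.2
    have ha : a ∈ J 0 := by rw [hac', Finset.mem_Icc]; exact ⟨le_rfl, hle⟩
    have hc : c ∈ J 0 := by rw [hac', Finset.mem_Icc]; exact ⟨hle, le_rfl⟩
    rw [hmem, zero_add, pow_one] at ha hc
    refine ⟨a, c, ?_, ha, hc⟩
    rw [hac', Fin.card_Icc] at hcard
    omega
  · right
    have h2 : 2 ≤ (J R).card := by
      rw [← Finset.card_pair hij]
      refine Finset.card_le_card fun l hl => ?_
      rw [Finset.mem_insert, Finset.mem_singleton] at hl
      rcases hl with rfl | rfl
      · exact hi R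
      · exact hjR
    obtain ⟨m, hm, hmeq⟩ := exists_succ_eq_of_card_le J (fun m => hanti _ _ (by omega)) hcard h2
    obtain ⟨a, c, hac⟩ := exists_nearby_eq_Icc hA₀ blk x i (ε := θ ^ (m + 1)) (by positivity)
    have hac' : J m = Finset.Icc a c := hac
    refine ⟨m, hm, a, c, ?_, ?_, ?_⟩
    · rw [← hac']; exact hanti m R hm.le hjR
    · intro l hl
      rw [← hac', ← hmeq, hmem] at hl
      exact hl
    · intro l hl
      rw [← hac', hmem, not_le] at hl
      exact hl.le

variable [Fintype ι] [DecidableEq ι] {μ : Measure ℝ} [IsProbabilityMeasure μ] {M : ℝ}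

theorem measureReal_compl_unitCube
    (hμ : ∀ T : Set ℝ, μ.real T ≤ M * volume.real (T ∩ Set.Icc 0 1)) :
    (Measure.pi fun _ : ι => μ).real {x | ∃ k, x k ∉ Set.Icc (0 : ℝ) 1} ≤ 0 := by
  have hsub : {x : ι → ℝ | ∃ k, x k ∉ Set.Icc (0 : ℝ) 1} ⊆ ⋃ k, {x | x k ∈ (Set.Icc (0 : ℝ) 1)ᶜ} := by
    rintro x ⟨k, hk⟩
    exact Set.mem_iUnion.mpr ⟨k, hk⟩
  refine (measureReal_mono hsub).trans ((measureReal_iUnion_fintype_le _).trans ?_)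
  refine Finset.sum_nonpos fun k _ => ?_
  have := pi_measureReal_le_of_sections (μ := μ) k (S := {x | x k ∈ (Set.Icc (0 : ℝ) 1)ᶜ})
    ((measurable_pi_apply k) measurableSet_Icc.compl) MeasurableSet.univ (Set.subset_univ _)
    (fun _ _ _ => trivial) le_rfl fun x => ?_
  · simpa using this
  · have e : {τ | Function.update x k τ ∈ {x : ι → ℝ | x k ∈ (Set.Icc (0 : ℝ) 1)ᶜ}}
        = (Set.Icc (0 : ℝ) 1)ᶜ := by ext τ; simp
    rw [e]
    refine (hμ _).trans ?_
    simp

/-- Level spacing estimate for the block model in an energy interval in which the single-site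
potentials are not close to scalars on two-dimensional spectral subspaces. -/
theorem measureReal_spacing_le {R : ℕ}
    (hR : ∀ k, (Finset.univ.filter fun s => blk s = k).card ≤ R) (hM : 0 ≤ M)
    (hμ : ∀ T : Set ℝ, μ.real T ≤ M * volume.real (T ∩ Set.Icc 0 1))
    {η : ℝ} (hη : 0 < η) (hη' : η ≤ 1) {c₀ c₁ : ℝ} (hc : c₀ ≤ c₁)
    (hNS : NonScalar hA₀ blk η (Set.Icc c₀ c₁)) {θ : ℝ} (hθ : 0 < θ) (hθ' : θ ≤ 1) :
    (Measure.pi fun _ : ι => μ).real {x | ∃ i j, i ≠ j ∧ level hA₀ blk i x ∈ Set.Icc c₀ c₁ ∧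
        level hA₀ blk j x ∈ Set.Icc c₀ c₁ ∧
        |level hA₀ blk i x - level hA₀ blk j x| ≤ θ ^ (R + 1)}
      ≤ (Fintype.card n : ℝ) ^ 2 * ((c₁ - c₀) / θ + 1) *
          (2 * (Fintype.card ι * (M * (2 * (3 * θ)))) ^ 2)
        + R * (Fintype.card n : ℝ) ^ 4 * Fintype.card ι * (M * (576 * θ / η ^ 2)) := by
  set π := Measure.pi fun _ : ι => μ
  set I := Set.Icc c₀ c₁ with hI
  set N := Fintype.card n with hN
  set Z := ⌊(c₁ - c₀) / θ⌋₊ + 1 with hZ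
  let S₁ : Fin N × Fin N × Fin Z → Set (ι → ℝ) := fun q =>
    if (q.1 : ℕ) + R ≤ q.2.1 then
      {x | level hA₀ blk q.1 x ∈ Set.Icc (c₀ + (q.2.2 + 2) * θ - 3 * θ) (c₀ + (q.2.2 + 2) * θ) ∧
        level hA₀ blk q.2.1 x ∈ Set.Icc (c₀ + (q.2.2 + 2) * θ - 3 * θ) (c₀ + (q.2.2 + 2) * θ)}
    else ∅
  let S₂ : Fin R × (Fin N × Fin N) × (Fin N × Fin N) × ι → Set (ι → ℝ) := fun q =>
    breakable hA₀ blk q.2.1.1 q.2.1.2 (Finset.Icc q.2.2.1.1 q.2.2.1.2) (θ ^ ((q.1 : ℕ) + 2))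
      (θ ^ ((q.1 : ℕ) + 1)) (8 * θ ^ ((q.1 : ℕ) + 2) / η) (θ ^ ((q.1 : ℕ) + 1) * η / 36) I q.2.2.2
  have hcov : {x | ∃ i j, i ≠ j ∧ level hA₀ blk i x ∈ I ∧ level hA₀ blk j x ∈ I ∧
      |level hA₀ blk i x - level hA₀ blk j x| ≤ θ ^ (R + 1)}
      ⊆ {x | ∃ k, x k ∉ Set.Icc (0 : ℝ) 1} ∪ ((⋃ q, S₁ q) ∪ ⋃ q, S₂ q) := by
    rintro x ⟨i, j, hij, hiI, hjI, hclose⟩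
    by_cases hx : ∃ k, x k ∉ Set.Icc (0 : ℝ) 1
    · exact Or.inl hx
    right
    push Not at hx
    rcases exists_cluster hA₀ blk hθ hθ' x hij hclose with ⟨l, l', hll, h1, h2⟩ | ⟨m, hm, a, c, hj, hK⟩
    · left
      have hpos : 0 ≤ (level hA₀ blk i x - c₀) / θ := div_nonneg (by linarith [hiI.1]) hθ.le
      have hz : ⌊(level hA₀ blk i x - c₀) / θ⌋₊ < Z :=
        Nat.lt_succ_of_le (Nat.floor_mono (div_le_div_of_nonneg_right (by linarith [hiI.2]) hθ.le))
      refine Set.mem_iUnion.mpr ⟨(l, l', ⟨_, hz⟩), ?_⟩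
      have e1 := Nat.floor_le hpos
      rw [le_div_iff₀ hθ] at e1
      have e2 := (Nat.lt_floor_add_one ((level hA₀ blk i x - c₀) / θ)).le
      rw [div_le_iff₀ hθ] at e2
      rw [abs_le] at h1 h2
      simp only [S₁, if_pos hll]
      refine ⟨⟨?_, ?_⟩, ?_, ?_⟩ <;> linarith
    · right
      obtain ⟨k, hk⟩ := exists_mem_breakable hA₀ blk hη hη' hNS (by positivity) (by positivity)
        hij hj hx hK hiI hjI
      exact Set.mem_iUnion.mpr ⟨(⟨m, hm⟩, (i, j), (a, c), k), hk⟩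
  have b0 := measureReal_compl_unitCube (ι := ι) hμ
  have b1 : π.real (⋃ q, S₁ q) ≤ (N : ℝ) ^ 2 * ((c₁ - c₀) / θ + 1) *
      (2 * (Fintype.card ι * (M * (2 * (3 * θ)))) ^ 2) := by
    refine (measureReal_iUnion_fintype_le _).trans ((Finset.sum_le_card_nsmul _ _
      (2 * (Fintype.card ι * (M * (2 * (3 * θ)))) ^ 2) fun q _ => ?_).trans ?_)
    · simp only [S₁]
      split_ifs with hq
      · exact minami hA₀ blk hR hM hμ hq _ (by positivity)
      · simp; positivity
    · rw [nsmul_eq_mul]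
      refine mul_le_mul_of_nonneg_right ?_ (by positivity)
      simp only [Finset.card_univ, Fintype.card_prod, Fintype.card_fin, hZ]
      push_cast
      have := Nat.floor_le (div_nonneg (sub_nonneg.mpr hc) hθ.le)
      calc (N : ℝ) * (N * (⌊(c₁ - c₀) / θ⌋₊ + 1)) = N ^ 2 * (⌊(c₁ - c₀) / θ⌋₊ + 1) := by ring
        _ ≤ _ := by gcongr
  have b2 : π.real (⋃ q, S₂ q)
      ≤ R * (N : ℝ) ^ 4 * Fintype.card ι * (M * (576 * θ / η ^ 2)) := by
    refine (measureReal_iUnion_fintype_le _).trans ((Finset.sum_le_card_nsmul _ _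
      (M * (576 * θ / η ^ 2)) fun q _ => ?_).trans (le_of_eq ?_))
    · have hp : 0 < θ ^ ((q.1 : ℕ) + 1) := by positivity
      have hp1 : θ ^ ((q.1 : ℕ) + 1) ≤ 1 := pow_le_one₀ hθ.le hθ'
      refine (measureReal_breakable_le hA₀ blk hM hμ _ _ _ _ _ (by positivity) (by positivity)
        ?_ isClosed_Icc _).trans (le_of_eq ?_)
      · nlinarith
      · rw [pow_succ θ ((q.1 : ℕ) + 1)]
        field_simp
        ring
    · rw [nsmul_eq_mul]
      congr 1
      simp only [Finset.card_univ, Fintype.card_prod, Fintype.card_fin]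
      push_cast
      ring
  refine (measureReal_mono hcov).trans ((measureReal_union_le _ _).trans ?_)
  have := measureReal_union_le (μ := π) (⋃ q, S₁ q) (⋃ q, S₂ q)
  linarith

end Spacing

section Lattice

variable {d : ℕ}

theorem mem_cube {s : ℕ} {a x : Fin d → ℤ} : x ∈ cube s a ↔ ∀ j, a j ≤ x j ∧ x j < a j + s := by
  simp [cube]

theorem card_cube (s : ℕ) (a : Fin d → ℤ) : (cube s a).card = s ^ d := by
  simp [cube, Fintype.card_piFinset]

/-- The corner of the block of side length `r` containing a point. -/
def corner (r : ℕ) (x : Fin d → ℤ) : Sublattice d r :=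
  ⟨fun j => r * (x j / r), fun _ => dvd_mul_right _ _⟩

theorem mem_cube_iff_corner {r : ℕ} (hr : 1 ≤ r) (k : Sublattice d r) (x : Fin d → ℤ) :
    x ∈ cube r k.1 ↔ corner r x = k := by
  have hr' : (0 : ℤ) < r := by exact_mod_cast hr
  rw [mem_cube, Subtype.ext_iff, funext_iff]
  refine forall_congr' fun j => ?_
  obtain ⟨m, hm⟩ := k.2 j
  simp only [corner, hm]
  constructor
  · rintro ⟨h1, h2⟩
    congr 1
    refine le_antisymm (Int.lt_add_one_iff.mp ?_) ?_
    · rw [Int.ediv_lt_iff_lt_mul hr']; linarith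
    · rw [Int.le_ediv_iff_mul_le hr']; linarith
  · intro h
    have h3 : x j / r = m := mul_left_cancel₀ hr'.ne' h
    constructor
    · rw [← h3]; exact Int.mul_ediv_self_le hr'.ne'
    · rw [← h3]; exact Int.lt_mul_ediv_self_add hr'

theorem corner_mem_blockIndex {r L : ℕ} (hr : 1 ≤ r) (a : Sublattice d r) {x : Fin d → ℤ}
    (hx : x ∈ cube L a.1) : corner r x ∈ blockIndex r (cube L a.1) := by
  have hr' : (0 : ℤ) < r := by exact_mod_cast hr
  rw [blockIndex, Finset.mem_subtype, mem_cube]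
  intro j
  have hxj := mem_cube.mp hx j
  obtain ⟨m, hm⟩ := a.2 j
  have h1 : (r : ℤ) * (x j / r) ≤ x j := Int.mul_ediv_self_le hr'.ne'
  refine ⟨?_, h1.trans_lt hxj.2⟩
  rw [hm] at hxj ⊢
  exact mul_le_mul_of_nonneg_left ((Int.le_ediv_iff_mul_le hr').mpr (by linarith)) hr'.le

/-- The map assigning to each site of a cube the block containing it. -/
def siteBlock {r L : ℕ} (hr : 1 ≤ r) (a : Sublattice d r) (x : cube L a.1) :
    blockIndex r (cube L a.1) :=
  ⟨corner r x.1, corner_mem_blockIndex hr a x.2⟩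

theorem siteBlock_eq_iff {r L : ℕ} (hr : 1 ≤ r) (a : Sublattice d r) (x : cube L a.1)
    (k : blockIndex r (cube L a.1)) : siteBlock hr a x = k ↔ x.1 ∈ cube r k.1.1 := by
  rw [mem_cube_iff_corner hr, Subtype.ext_iff, siteBlock]

theorem card_siteBlock_fiber_le {r L : ℕ} (hr : 1 ≤ r) (a : Sublattice d r)
    (k : blockIndex r (cube L a.1)) :
    (Finset.univ.filter fun x => siteBlock hr a x = k).card ≤ r ^ d := by
  rw [← card_cube r k.1.1]
  refine Finset.card_le_card_of_injOn Subtype.val (fun x hx => ?_) Subtype.val_injective.injOn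
  simp only [Finset.coe_filter, Finset.mem_univ, true_and, Set.mem_ofPred_eq] at hx
  exact (siteBlock_eq_iff hr a x k).mp hx

theorem card_blockIndex_le (r : ℕ) (Λ : Finset (Fin d → ℤ)) :
    Fintype.card (blockIndex r Λ) ≤ Fintype.card Λ := by
  rw [Fintype.card_coe, Fintype.card_coe, blockIndex, Finset.card_subtype]
  exact Finset.card_filter_le _ _

theorem localHamiltonian_eq_blockModel {r L : ℕ} (hr : 1 ≤ r) (a : Sublattice d r)
    (ω : Sublattice d r → ℝ) :
    localHamiltonian (cube L a.1) ω = blockModel (localFreeHamiltonian (cube L a.1))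
      (siteBlock hr a) (fun k => ω k.1) := by
  rw [localHamiltonian, blockModel]
  congr 1
  ext x y
  rw [localPotential, Matrix.sum_apply]
  by_cases h : x = y
  · subst h
    simp only [Matrix.smul_apply, blockProjection, diagonal_apply_eq, Function.comp, smul_eq_mul, siteBlock,
      mul_ite, mul_one, mul_zero, mem_cube_iff_corner hr]
    rw [Finset.sum_ite_eq, if_pos (corner_mem_blockIndex hr a x.2)]
  · rw [diagonal_apply_ne _ h]
    refine Finset.sum_eq_zero fun k _ => ?_
    simp [blockProjection, diagonal_apply_ne _ h]

/-- Extension by zero of a function on a finite set of sites. -/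
def extend (Λ : Finset (Fin d → ℤ)) (u : Λ → ℝ) (x : Fin d → ℤ) : ℝ :=
  if h : x ∈ Λ then u ⟨x, h⟩ else 0

theorem extend_coe (Λ : Finset (Fin d → ℤ)) (u : Λ → ℝ) (x : Λ) : extend Λ u x = u x := by
  simp [extend]

theorem extend_of_notMem {Λ : Finset (Fin d → ℤ)} (u : Λ → ℝ) {x : Fin d → ℤ} (hx : x ∉ Λ) :
    extend Λ u x = 0 := by
  simp [extend, hx]

theorem localFreeHamiltonian_mulVec (Λ : Finset (Fin d → ℤ)) (u : Λ → ℝ) (x : Λ) :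
    (localFreeHamiltonian Λ *ᵥ u) x = freeHamiltonian (extend Λ u) x := by
  have h : ∀ z : Fin d → ℤ,
      ∑ y : Λ, (Pi.single (y : Fin d → ℤ) (1 : ℝ) : (Fin d → ℤ) → ℝ) z * u y = extend Λ u z := by
    intro z
    by_cases hz : z ∈ Λ
    · rw [Finset.sum_eq_single ⟨z, hz⟩]
      · simp [extend, hz]
      · intro y _ hy
        rw [Pi.single_eq_of_ne, zero_mul]
        intro e; exact hy (Subtype.ext e.symm)
      · simp
    · rw [extend_of_notMem u hz]
      refine Finset.sum_eq_zero fun y _ => ?_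
      rw [Pi.single_eq_of_ne, zero_mul]
      intro e; exact hz (e ▸ y.2)
  simp only [mulVec, dotProduct, localFreeHamiltonian, of_apply, freeHamiltonian]
  rw [← h]
  simp only [← h, sub_mul, Finset.sum_sub_distrib, Finset.sum_mul, Finset.mul_sum]
  congr 1
  · exact Finset.sum_congr rfl fun y _ => by ring
  · rw [Finset.sum_comm]
    refine Finset.sum_congr rfl fun j _ => ?_
    simp only [add_mul, Finset.sum_add_distrib]

theorem tsum_sq_sub {G : Type*} [AddGroup G] {f : G → ℝ} {Λ : Finset G}
    (hf : ∀ x ∉ Λ, f x = 0) (e : G) :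
    (Summable fun x => (f (x + e) - f x) ^ 2) ∧
    ∑ x ∈ Λ, (2 * f x ^ 2 - (f x * f (x + e) + f x * f (x - e))) = ∑' x, (f (x + e) - f x) ^ 2 := by
  have s0 : Summable fun x => f x ^ 2 :=
    summable_of_ne_finset_zero (s := Λ) fun x hx => by simp [hf x hx]
  have s1 : Summable fun x => f (x + e) ^ 2 := s0.comp_injective (add_left_injective e)
  have s2 : Summable fun x => f x * f (x + e) :=
    summable_of_ne_finset_zero (s := Λ) fun x hx => by simp [hf x hx]
  have s3 : Summable fun x => f x * f (x - e) :=
    summable_of_ne_finset_zero (s := Λ) fun x hx => by simp [hf x hx]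
  have t1 : ∑' x, f (x + e) ^ 2 = ∑' x, f x ^ 2 := (Equiv.addRight e).tsum_eq fun x => f x ^ 2
  have t2 : ∑' x, f x * f (x - e) = ∑' x, f x * f (x + e) := by
    rw [← (Equiv.addRight e).tsum_eq fun x => f x * f (x - e)]
    refine tsum_congr fun x => ?_
    rw [Equiv.coe_addRight, add_sub_cancel_right, mul_comm]
  have e3 : (fun x => (f (x + e) - f x) ^ 2)
      = fun x => (f (x + e) ^ 2 + f x ^ 2) - 2 * (f x * f (x + e)) := funext fun x => by ring
  have e4 : ∑ x ∈ Λ, (2 * f x ^ 2 - (f x * f (x + e) + f x * f (x - e)))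
      = ∑' x, (2 * f x ^ 2 - (f x * f (x + e) + f x * f (x - e))) :=
    (tsum_eq_sum fun x hx => by simp [hf x hx]).symm
  rw [e3, e4]
  refine ⟨(s1.add s0).sub (s2.mul_left 2), ?_⟩
  rw [Summable.tsum_sub (s1.add s0) (s2.mul_left 2), Summable.tsum_add s1 s0, t1, tsum_mul_left,
    Summable.tsum_sub (s0.mul_left 2) (s2.add s3), Summable.tsum_add s2 s3, t2, tsum_mul_left]
  ring

/-- The quadratic form of the Laplacian as a sum over bonds. -/
theorem sum_mul_freeHamiltonian {Λ : Finset (Fin d → ℤ)} {f : (Fin d → ℤ) → ℝ}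
    (hf : ∀ x ∉ Λ, f x = 0) :
    (Summable fun x => ∑ j, (f (x + Pi.single j 1) - f x) ^ 2) ∧
    ∑ x ∈ Λ, f x * freeHamiltonian f x = ∑' x, ∑ j, (f (x + Pi.single j 1) - f x) ^ 2 := by
  have sj : ∀ j : Fin d, Summable fun x => (f (x + Pi.single j 1) - f x) ^ 2 := fun j =>
    (tsum_sq_sub hf _).1
  refine ⟨summable_sum fun j _ => sj j, ?_⟩
  have e2 : ∀ x, f x * freeHamiltonian f x
      = ∑ j : Fin d, (2 * f x ^ 2 - (f x * f (x + Pi.single j 1) + f x * f (x - Pi.single j 1))) := by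
    intro x
    rw [Finset.sum_sub_distrib, freeHamiltonian, mul_sub, Finset.mul_sum]
    simp only [mul_add, Finset.sum_const, Finset.card_univ, Fintype.card_fin, nsmul_eq_mul]
    ring
  rw [Summable.tsum_finsetSum fun j _ => sj j]
  simp only [e2]
  rw [Finset.sum_comm]
  exact Finset.sum_congr rfl fun j _ => (tsum_sq_sub hf _).2

/-- The restriction of a function on the lattice to a block, in relative coordinates. -/
def blockRestrict (r : ℕ) (k : Fin d → ℤ) (f : (Fin d → ℤ) → ℝ) (y : Fin d → Fin r) : ℝ :=
  f fun j => k j + (y j : ℕ)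

theorem corner_add {r : ℕ} (hr : 1 ≤ r) (k : Sublattice d r) (y : Fin d → Fin r) :
    corner r (fun j => k.1 j + ((y j : ℕ) : ℤ)) = k := by
  rw [← mem_cube_iff_corner hr, mem_cube]
  intro j
  have := (y j).2
  constructor <;> simp

/-- Neumann bracketing: the Dirichlet forms of the blocks add up to at most the full form. -/
theorem sum_boxEnergy_le {r : ℕ} (hr : 1 ≤ r) (B : Finset (Sublattice d r))
    {Λ : Finset (Fin d → ℤ)} {f : (Fin d → ℤ) → ℝ} (hf : ∀ x ∉ Λ, f x = 0) :
    ∑ k ∈ B, boxEnergy d r (blockRestrict r k.1 f) ≤ ∑ x ∈ Λ, f x * freeHamiltonian f x := by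
  obtain ⟨hs, he⟩ := sum_mul_freeHamiltonian hf
  rw [he]
  set F : (Fin d → ℤ) → ℝ := fun x => ∑ j, (f (x + Pi.single j 1) - f x) ^ 2 with hF
  have hF0 : ∀ x, 0 ≤ F x := fun x => Finset.sum_nonneg fun j _ => sq_nonneg _
  let φ : Sublattice d r × (Fin d → Fin r) → (Fin d → ℤ) := fun q j => q.1.1 j + ((q.2 j : ℕ) : ℤ)
  have hφ : Function.Injective φ := by
    rintro ⟨k, y⟩ ⟨k', y'⟩ h
    have h1 : k = k' := by
      rw [← corner_add hr k y, ← corner_add hr k' y']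
      exact congrArg _ h
    subst h1
    refine Prod.ext rfl (funext fun j => Fin.ext ?_)
    have := congrFun h j
    simpa [φ] using this
  have h1 : ∀ k ∈ B, boxEnergy d r (blockRestrict r k.1 f) ≤ ∑ y : Fin d → Fin r, F (φ (k, y)) := by
    intro k _
    refine Finset.sum_le_sum fun y _ => Finset.sum_le_sum fun j _ => ?_
    have hval : ∀ q : Fin r, (y j : ℕ) + 1 = q →
        blockRestrict r k.1 f (Function.update y j q) = f (φ (k, y) + Pi.single j 1) := by
      intro q hq
      refine congrArg f (funext fun l => ?_)
      by_cases hl : l = j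
      · subst hl
        simp [φ, ← hq]; ring
      · simp [φ, Function.update_of_ne hl, Pi.single_eq_of_ne hl]
    by_cases hy : (y j : ℕ) + 1 < r
    · rw [Finset.sum_eq_single ⟨(y j : ℕ) + 1, hy⟩]
      · rw [if_pos rfl, hval _ rfl]; rfl
      · intro q _ hq
        rw [if_neg]
        intro e; exact hq (Fin.ext e.symm)
      · simp
    · rw [Finset.sum_eq_zero]
      · positivity
      · intro q _
        rw [if_neg]
        have := q.2
        omega
  refine (Finset.sum_le_sum h1).trans ?_
  rw [← Finset.sum_product' B Finset.univ fun k y => F (φ (k, y))]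
  have := Summable.sum_le_tsum ((B ×ˢ Finset.univ).map ⟨φ, hφ⟩) (fun x _ => hF0 x) hs
  rw [Finset.sum_map] at this
  exact this

theorem boxEnergy_rotate {d r : ℕ} (f g : (Fin d → Fin r) → ℝ) {α β : ℝ} (h : α ^ 2 + β ^ 2 = 1) :
    boxEnergy d r (fun y => α * f y + β * g y) ≤ boxEnergy d r f + boxEnergy d r g := by
  simp only [boxEnergy, ← Finset.sum_add_distrib]
  refine Finset.sum_le_sum fun y _ => Finset.sum_le_sum fun j _ => Finset.sum_le_sum fun q _ => ?_
  split_ifs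
  · nlinarith [sq_nonneg (α * (g (Function.update y j q) - g y) - β * (f (Function.update y j q) - f y))]
  · simp

theorem exists_unit_combination_eq_zero (p q : ℝ) :
    ∃ α β : ℝ, α ^ 2 + β ^ 2 = 1 ∧ α * p + β * q = 0 := by
  by_cases h : p ^ 2 + q ^ 2 = 0
  · have hp : p = 0 := by nlinarith [sq_nonneg p, sq_nonneg q]
    have hq : q = 0 := by nlinarith [sq_nonneg p, sq_nonneg q]
    exact ⟨1, 0, by norm_num, by simp [hp]⟩
  · have hpos : 0 < p ^ 2 + q ^ 2 := lt_of_le_of_ne (by positivity) (Ne.symm h)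
    refine ⟨q / √(p ^ 2 + q ^ 2), -p / √(p ^ 2 + q ^ 2), ?_, ?_⟩
    · rw [div_pow, div_pow, Real.sq_sqrt hpos.le]
      field_simp
      ring
    · field_simp
      ring

/-- If the mass in each block is almost the same for all normalized combinations of `f` and `g`,
then the kinetic energies of `f` and `g` cannot both be small. -/
theorem energy_lower_bound {r : ℕ} (hr : 1 ≤ r) (B : Finset (Sublattice d r))
    {Λ : Finset (Fin d → ℤ)} {f g : (Fin d → ℤ) → ℝ} (hf : ∀ x ∉ Λ, f x = 0)
    (hg : ∀ x ∉ Λ, g x = 0) {η : ℝ}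
    (h : ∀ k ∈ B, ∃ c : ℝ, ∀ α β : ℝ, α ^ 2 + β ^ 2 = 1 →
      |∑ y, (α * blockRestrict r k.1 f y + β * blockRestrict r k.1 g y) ^ 2 - c| ≤ η) :
    2 * (1 - Real.cos (Real.pi / r)) * ∑ k ∈ B, (∑ y, blockRestrict r k.1 f y ^ 2 - 2 * η)
      ≤ ∑ x ∈ Λ, f x * freeHamiltonian f x + ∑ x ∈ Λ, g x * freeHamiltonian g x := by
  refine le_trans ?_ (add_le_add (sum_boxEnergy_le hr B hf) (sum_boxEnergy_le hr B hg))
  rw [Finset.mul_sum, ← Finset.sum_add_distrib]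
  refine Finset.sum_le_sum fun k hk => ?_
  obtain ⟨c, hc⟩ := h k hk
  obtain ⟨α, β, hαβ, h0⟩ := exists_unit_combination_eq_zero (∑ y, blockRestrict r k.1 f y)
    (∑ y, blockRestrict r k.1 g y)
  refine le_trans ?_ (boxEnergy_rotate _ _ hαβ)
  refine le_trans ?_ (poincare_box d r _ (by
    rw [Finset.sum_add_distrib, ← Finset.mul_sum, ← Finset.mul_sum, h0]))
  refine mul_le_mul_of_nonneg_left ?_ (by linarith [Real.cos_le_one (Real.pi / r)])
  have h1 := (abs_le.mp (hc α β hαβ)).1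
  have h2 := (abs_le.mp (hc 1 0 (by norm_num))).2
  simp only [one_mul, zero_mul, add_zero] at h2
  linarith

theorem sum_blockRestrict {r : ℕ} (k : Fin d → ℤ) (F : (Fin d → ℤ) → ℝ) :
    ∑ y, blockRestrict r k F y = ∑ x ∈ cube r k, F x := by
  refine Finset.sum_bij (fun y _ j => k j + ((y j : ℕ) : ℤ)) (fun y _ => ?_) (fun y _ y' _ h => ?_)
    (fun x hx => ?_) fun y _ => rfl
  · rw [mem_cube]
    intro j
    have := (y j).2
    constructor <;> simp
  · refine funext fun j => Fin.ext ?_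
    have := congrFun h j
    simpa using this
  · rw [mem_cube] at hx
    refine ⟨fun j => ⟨(x j - k j).toNat, ?_⟩, Finset.mem_univ _, funext fun j => ?_⟩
    · have := hx j; omega
    · have := hx j
      simp only
      omega

theorem sum_blockRestrict_eq_sum_siteBlock {r L : ℕ} (hr : 1 ≤ r) (a : Sublattice d r)
    (k : blockIndex r (cube L a.1)) {F : (Fin d → ℤ) → ℝ} (hF : ∀ x ∉ cube L a.1, F x = 0) :
    ∑ y, blockRestrict r k.1.1 F y
      = ∑ s : cube L a.1, if siteBlock hr a s = k then F s else 0 := by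
  rw [sum_blockRestrict]
  simp only [siteBlock_eq_iff]
  rw [Finset.sum_coe_sort (cube L a.1) fun x => if x ∈ cube r k.1.1 then F x else 0,
    ← Finset.sum_filter, Finset.filter_mem_eq_inter, Finset.inter_comm]
  symm
  refine Finset.sum_subset Finset.inter_subset_left fun x hx hx' => hF x fun h => hx' ?_
  exact Finset.mem_inter.mpr ⟨hx, h⟩

/-- Multiplication by `(-1) ^ (x₁ + ⋯ + x_d)`. -/
def stagger (f : (Fin d → ℤ) → ℝ) (x : Fin d → ℤ) : ℝ := (-1) ^ (∑ j, x j) * f x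

theorem stagger_mul_stagger (f g : (Fin d → ℤ) → ℝ) (x : Fin d → ℤ) :
    stagger f x * stagger g x = f x * g x := by
  have : ((-1 : ℝ) ^ (∑ j, x j)) * (-1 : ℝ) ^ (∑ j, x j) = 1 := by
    rw [← mul_zpow]; simp
  rw [stagger, stagger]
  linear_combination (f x * g x) * this

theorem freeHamiltonian_stagger (f : (Fin d → ℤ) → ℝ) (x : Fin d → ℤ) :
    freeHamiltonian (stagger f) x = stagger (fun x => 4 * d * f x - freeHamiltonian f x) x := by
  have h1 : ∀ j : Fin d, stagger f (x + Pi.single j 1)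
      = - ((-1) ^ (∑ j, x j) * f (x + Pi.single j 1)) := by
    intro j
    simp only [stagger, Pi.add_apply, Finset.sum_add_distrib, Finset.sum_pi_single',
      Finset.mem_univ, if_true]
    rw [zpow_add₀ (by norm_num)]; simp
  have h2 : ∀ j : Fin d, stagger f (x - Pi.single j 1)
      = - ((-1) ^ (∑ j, x j) * f (x - Pi.single j 1)) := by
    intro j
    simp only [stagger, Pi.sub_apply, Finset.sum_sub_distrib, Finset.sum_pi_single',
      Finset.mem_univ, if_true]
    rw [zpow_sub₀ (by norm_num)]; simp [div_neg]
  rw [freeHamiltonian]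
  simp only [h1, h2]
  simp only [stagger, freeHamiltonian, Finset.sum_add_distrib, Finset.sum_neg_distrib,
    ← Finset.mul_sum]
  ring

end Lattice

section NonScalar

variable {d r L : ℕ}

theorem sum_mul_freeHamiltonian_extend (Λ : Finset (Fin d → ℤ)) (u : Λ → ℝ) :
    ∑ x ∈ Λ, extend Λ u x * freeHamiltonian (extend Λ u) x = u ⬝ᵥ (localFreeHamiltonian Λ *ᵥ u) := by
  rw [← Finset.sum_coe_sort, dotProduct]
  refine Finset.sum_congr rfl fun x _ => ?_
  rw [localFreeHamiltonian_mulVec, extend_coe]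

theorem energy_lower_bound_of_nearly_scalar (hr : 1 ≤ r) (a : Sublattice d r)
    {σ : (Fin d → ℤ) → ℝ} (hσ : ∀ x, σ x ^ 2 = 1) {u w : cube L a.1 → ℝ} (hu : u ⬝ᵥ u = 1) {η : ℝ}
    (h : ∀ k, ∃ c : ℝ, ∀ α β : ℝ, α ^ 2 + β ^ 2 = 1 →
      |(∑ s, if siteBlock hr a s = k then (α * u s + β * w s) ^ 2 else 0) - c| ≤ η) :
    2 * (1 - Real.cos (Real.pi / r))
        * (1 - 2 * η * Fintype.card (blockIndex r (cube L a.1)))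
      ≤ ∑ x ∈ cube L a.1, (σ x * extend _ u x) * freeHamiltonian (fun x => σ x * extend _ u x) x
        + ∑ x ∈ cube L a.1,
          (σ x * extend _ w x) * freeHamiltonian (fun x => σ x * extend _ w x) x := by
  have hmass : ∀ (k : blockIndex r (cube L a.1)) (α β : ℝ),
      ∑ y, (α * blockRestrict r k.1.1 (fun x => σ x * extend _ u x) y
        + β * blockRestrict r k.1.1 (fun x => σ x * extend _ w x) y) ^ 2
      = ∑ s, if siteBlock hr a s = k then (α * u s + β * w s) ^ 2 else 0 := by
    intro k α β
    have := sum_blockRestrict_eq_sum_siteBlock hr a k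
      (F := fun x => (α * extend (cube L a.1) u x + β * extend (cube L a.1) w x) ^ 2)
      fun x hx => by simp [extend_of_notMem _ hx]
    simp only [extend_coe] at this
    rw [← this]
    refine Finset.sum_congr rfl fun y _ => ?_
    simp only [blockRestrict]
    set z : Fin d → ℤ := fun j => k.1.1 j + ((y j : ℕ) : ℤ)
    linear_combination (α * extend (cube L a.1) u z + β * extend (cube L a.1) w z) ^ 2 * hσ z
  have hmass1 : ∑ k ∈ blockIndex r (cube L a.1),
      (∑ y, blockRestrict r k.1 (fun x => σ x * extend _ u x) y ^ 2 - 2 * η)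
      = 1 - 2 * η * Fintype.card (blockIndex r (cube L a.1)) := by
    rw [← Finset.sum_coe_sort, Finset.sum_sub_distrib]
    congr 1
    · have := fun k => hmass k 1 0
      simp only [one_mul, zero_mul, add_zero] at this
      simp only [this]
      rw [Finset.sum_comm]
      simp only [Finset.sum_ite_eq, Finset.mem_univ, if_true]
      rw [← hu, dotProduct]
      exact Finset.sum_congr rfl fun s _ => sq _
    · simp; ring
  rw [← hmass1]
  refine energy_lower_bound hr _ (fun x hx => by simp [extend_of_notMem _ hx])
    (fun x hx => by simp [extend_of_notMem _ hx]) fun k hk => ?_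
  obtain ⟨c, hc⟩ := h ⟨k, hk⟩
  refine ⟨c, fun α β hαβ => ?_⟩
  have := hmass ⟨k, hk⟩ α β
  simp only at this
  rw [this]
  exact hc α β hαβ

theorem level_eq_form {n ι : Type*} [Fintype n] [DecidableEq n] {A₀ : Matrix n n ℝ}
    (hA₀ : A₀.IsHermitian) (blk : n → ι) (x : ι → ℝ) (i : Fin (Fintype.card n)) :
    level hA₀ blk i x = sortedEigenvector (isHermitian_blockModel hA₀ blk x) i ⬝ᵥ
          (A₀ *ᵥ sortedEigenvector (isHermitian_blockModel hA₀ blk x) i)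
        + ∑ s, x (blk s) * sortedEigenvector (isHermitian_blockModel hA₀ blk x) i s ^ 2 := by
  rw [level, ← eigenvalues₀_eq_of_eigenvector, form_blockModel]

/-- At the lower band edge the block potentials are not close to scalars on two-dimensional spectral
subspaces. -/
theorem nonScalar_lower (hr : 1 ≤ r) (a : Sublattice d r) {E η : ℝ}
    (hE : E < (1 - Real.cos (Real.pi / r))
      * (1 - 2 * η * Fintype.card (blockIndex r (cube L a.1)))) :
    NonScalar (isHermitian_localFreeHamiltonian (cube L a.1)) (siteBlock hr a) η (Set.Icc 0 E) := by
  intro x hx i j _ hi hj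
  by_contra hcon
  push Not at hcon
  set u := fun l => sortedEigenvector
    (isHermitian_blockModel (isHermitian_localFreeHamiltonian (cube L a.1)) (siteBlock hr a) x) l
  have hu : ∀ l, u l ⬝ᵥ u l = 1 := fun l => by simp [u, sortedEigenvector_dotProduct]
  have h := energy_lower_bound_of_nearly_scalar hr a (σ := fun _ => 1) (by simp) (w := u j) (hu i) hcon
  simp only [one_mul] at h
  rw [sum_mul_freeHamiltonian_extend, sum_mul_freeHamiltonian_extend] at h
  have hl : ∀ l, u l ⬝ᵥ (localFreeHamiltonian (cube L a.1) *ᵥ u l)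
      ≤ level (isHermitian_localFreeHamiltonian (cube L a.1)) (siteBlock hr a) l x := by
    intro l
    rw [level_eq_form]
    have : 0 ≤ ∑ s, x (siteBlock hr a s) * u l s ^ 2 :=
      Finset.sum_nonneg fun s _ => mul_nonneg (hx _).1 (sq_nonneg _)
    linarith
  linarith [hl i, hl j, hi.2, hj.2]

/-- At the upper band edge the block potentials are not close to scalars on two-dimensional spectral
subspaces. -/
theorem nonScalar_upper (hr : 1 ≤ r) (a : Sublattice d r) {E η : ℝ}
    (hE : E < (1 - Real.cos (Real.pi / r))
      * (1 - 2 * η * Fintype.card (blockIndex r (cube L a.1)))) :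
    NonScalar (isHermitian_localFreeHamiltonian (cube L a.1)) (siteBlock hr a) η
      (Set.Icc (4 * d + 1 - E) (4 * d + 1)) := by
  intro x hx i j _ hi hj
  by_contra hcon
  push Not at hcon
  set u := fun l => sortedEigenvector
    (isHermitian_blockModel (isHermitian_localFreeHamiltonian (cube L a.1)) (siteBlock hr a) x) l
  have hu : ∀ l, u l ⬝ᵥ u l = 1 := fun l => by simp [u, sortedEigenvector_dotProduct]
  have h := energy_lower_bound_of_nearly_scalar hr a (σ := fun x => (-1) ^ (∑ j, x j))
    (fun x => by rw [sq, ← mul_zpow]; simp) (w := u j) (hu i) hcon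
  have hs : ∀ l, ∑ x ∈ cube L a.1, ((-1) ^ (∑ j, x j) * extend (cube L a.1) (u l) x)
      * freeHamiltonian (fun x => (-1) ^ (∑ j, x j) * extend (cube L a.1) (u l) x) x
      = 4 * d - u l ⬝ᵥ (localFreeHamiltonian (cube L a.1) *ᵥ u l) := by
    intro l
    have e1 : ∀ x, ((-1) ^ (∑ j, x j) * extend (cube L a.1) (u l) x)
        * freeHamiltonian (fun x => (-1) ^ (∑ j, x j) * extend (cube L a.1) (u l) x) x
        = 4 * d * (extend (cube L a.1) (u l) x * extend (cube L a.1) (u l) x)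
          - extend (cube L a.1) (u l) x * freeHamiltonian (extend (cube L a.1) (u l)) x := by
      intro x
      have h1 := freeHamiltonian_stagger (extend (cube L a.1) (u l)) x
      have h2 := stagger_mul_stagger (extend (cube L a.1) (u l))
        (fun x => 4 * d * extend (cube L a.1) (u l) x
          - freeHamiltonian (extend (cube L a.1) (u l)) x) x
      rw [← h1] at h2
      refine Eq.trans h2 ?_
      ring
    simp only [e1]
    rw [Finset.sum_sub_distrib, sum_mul_freeHamiltonian_extend, ← Finset.mul_sum,
      ← Finset.sum_coe_sort]
    simp only [extend_coe]
    have := hu l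
    rw [dotProduct] at this
    rw [this, mul_one]
  rw [hs, hs] at h
  have hl : ∀ l, level (isHermitian_localFreeHamiltonian (cube L a.1)) (siteBlock hr a) l x
      ≤ u l ⬝ᵥ (localFreeHamiltonian (cube L a.1) *ᵥ u l) + 1 := by
    intro l
    rw [level_eq_form, ← hu l]
    refine add_le_add_right ?_ _
    rw [dotProduct]
    refine Finset.sum_le_sum fun s _ => ?_
    have := mul_le_mul_of_nonneg_right (hx (siteBlock hr a s)).2 (sq_nonneg (u l s))
    rw [one_mul] at this
    rw [← sq]
    exact this
  linarith [hl i, hl j, hi.1, hj.1]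

end NonScalar

section Probability

theorem measureReal_density_le {ρ : ℝ → ℝ} (hρ : Function.support ρ = Set.Icc 0 1) {M : ℝ}
    (hM : 0 ≤ M) (hb : ∀ x ∈ Set.Icc (0 : ℝ) 1, ρ x < M) (T : Set ℝ) :
    (volume.withDensity fun x => ENNReal.ofReal (ρ x)).real T
      ≤ M * volume.real (T ∩ Set.Icc 0 1) := by
  have h1 : (volume.withDensity fun x => ENNReal.ofReal (ρ x))
      ≤ (ENNReal.ofReal M) • (volume.restrict (Set.Icc (0 : ℝ) 1)) := by
    rw [← withDensity_const, ← withDensity_indicator measurableSet_Icc]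
    refine withDensity_mono (Filter.Eventually.of_forall fun x => ?_)
    by_cases hx : x ∈ Set.Icc (0 : ℝ) 1
    · simp only [Set.indicator_of_mem hx]
      exact ENNReal.ofReal_le_ofReal (hb x hx).le
    · have : ρ x = 0 := by
        rw [← Function.notMem_support, hρ]; exact hx
      simp [this]
  have h2 := h1 T
  rw [Measure.smul_apply, Measure.restrict_apply' measurableSet_Icc, smul_eq_mul] at h2
  have hfin : volume (T ∩ Set.Icc (0 : ℝ) 1) ≠ ⊤ :=
    measure_ne_top_of_subset Set.inter_subset_right (by simp)
  have := ENNReal.toReal_mono (ENNReal.mul_ne_top ENNReal.ofReal_ne_top hfin) h2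
  rwa [ENNReal.toReal_mul, ENNReal.toReal_ofReal hM] at this

theorem eigenvalues_congr {n : Type*} [Fintype n] [DecidableEq n] {A B : Matrix n n ℝ}
    (hA : A.IsHermitian) (hB : B.IsHermitian) (h : A = B) : hA.eigenvalues = hB.eigenvalues := by
  subst h; rfl

theorem exists_levels_of_levelSpacing_lt {d r L : ℕ} (hr : 1 ≤ r) (a : Sublattice d r)
    (ω : Sublattice d r → ℝ) {I : Set ℝ} {δ : ℝ}
    (h : levelSpacing I (isHermitian_localHamiltonian (cube L a.1) ω) < (δ : EReal)) :
    ∃ i j, i ≠ j ∧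
      level (isHermitian_localFreeHamiltonian (cube L a.1)) (siteBlock hr a) i (fun k => ω k.1) ∈ I ∧
      level (isHermitian_localFreeHamiltonian (cube L a.1)) (siteBlock hr a) j (fun k => ω k.1) ∈ I ∧
      |level (isHermitian_localFreeHamiltonian (cube L a.1)) (siteBlock hr a) i (fun k => ω k.1)
        - level (isHermitian_localFreeHamiltonian (cube L a.1)) (siteBlock hr a) j
          (fun k => ω k.1)| < δ := by
  rw [levelSpacing, eigenvalues_congr _ (isHermitian_blockModel
    (isHermitian_localFreeHamiltonian (cube L a.1)) (siteBlock hr a) (fun k => ω k.1))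
    (localHamiltonian_eq_blockModel hr a ω)] at h
  simp only [iInf_lt_iff] at h
  obtain ⟨j, k, hjk, hj, hk, hlt⟩ := h
  refine ⟨(Fintype.equivOfCardEq (Fintype.card_fin _)).symm j,
    (Fintype.equivOfCardEq (Fintype.card_fin _)).symm k, fun e => hjk ?_, hj, hk, ?_⟩
  · exact (Equiv.injective _) e
  · exact EReal.coe_lt_coe_iff.mp hlt

theorem map_coupling_eq_pi {Ω : Type*} [MeasurableSpace Ω] {P : Measure Ω} [IsProbabilityMeasure P]
    {d r : ℕ} {ρ : ℝ → ℝ} {ω : Sublattice d r → Ω → ℝ} (hω : IsRandomCoupling P ρ ω)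
    (B : Finset (Sublattice d r)) :
    P.map (fun η (k : B) => ω k.1 η)
      = Measure.pi fun _ : B => volume.withDensity fun x => ENNReal.ofReal (ρ x) := by
  have h1 : iIndepFun (fun k : B => ω k.1) P := hω.indep.precomp Subtype.val_injective
  refine ((iIndepFun_iff_map_fun_eq_pi_map fun k : B => (hω.measurable k.1).aemeasurable).mp h1).trans ?_
  simp only [hω.law]

end Probability

section Spacing

variable {d r : ℕ} {ρ : ℝ → ℝ}

/-- Polynomial form of the level spacing estimate: with `N` sites in the cube, the probability of a
spacing less than `θ ^ (r ^ d + 1)` is at most a constant times `N ^ 7 * θ`. -/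
theorem measureReal_levelSpacing_lt_le (hd : 1 ≤ d) (hr : 1 ≤ r) (hρ : IsSingleSiteDensity ρ) {E : ℝ}
    (hE : 0 < E) (hE' : E < 1 - Real.cos (Real.pi / r)) :
    ∃ C : ℝ, 0 < C ∧ ∀ (Ω : Type*) [MeasurableSpace Ω] (P : Measure Ω) [IsProbabilityMeasure P]
      (ω : Sublattice d r → Ω → ℝ), IsRandomCoupling P ρ ω →
      ∀ (L : ℕ) (a : Sublattice d r) (θ δ : ℝ), 1 ≤ L → 0 < θ → θ ≤ 1 → δ ≤ θ ^ (r ^ d + 1) →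
        P.real {η | levelSpacing (bandEdges d E) (isHermitian_localHamiltonian (cube L a.1)
          (fun k => ω k η)) < (δ : EReal)} ≤ C * ((L : ℝ) ^ d) ^ 7 * θ := by
  obtain ⟨m, M, hm, hmM⟩ := hρ.bounds
  have hM : 0 < M := by
    have := hmM 0 (by simp)
    linarith
  set γ := 1 - Real.cos (Real.pi / r) with hγ
  have hγ2 : γ ≤ 2 := by rw [hγ]; linarith [Real.neg_one_le_cos (Real.pi / r)]
  have hγ0 : 0 < γ := hE.trans hE'
  set κ := (γ - E) / (4 * γ) with hκ
  have hκ0 : 0 < κ := div_pos (by linarith) (by positivity)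
  have hκ1 : κ ≤ 1 := by rw [hκ, div_le_one (by positivity)]; linarith
  set R := r ^ d with hR
  set C₀ := 72 * (E + 1) * M ^ 2 + 576 * R * M / κ ^ 2 with hC₀
  refine ⟨2 * C₀, by positivity, fun Ω _ P _ ω hω L a θ δ hL hθ hθ' hδ => ?_⟩
  set Λ := cube L a.1 with hΛ
  have hcard : Fintype.card Λ = L ^ d := by rw [Fintype.card_coe, hΛ, card_cube]
  set N : ℝ := (L : ℝ) ^ d with hN
  have hcardN : (Fintype.card Λ : ℝ) = N := by rw [hcard]; push_cast; rfl
  have hN1 : 1 ≤ N := one_le_pow₀ (by exact_mod_cast hL)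
  set B := blockIndex r Λ with hB
  have hcB : (Fintype.card B : ℝ) ≤ N := by
    rw [← hcardN]; exact_mod_cast card_blockIndex_le r Λ
  set μ := volume.withDensity fun x => ENNReal.ofReal (ρ x) with hμdef
  have hprob : IsProbabilityMeasure μ :=
    ⟨by rw [hμdef, withDensity_apply _ MeasurableSet.univ, setLIntegral_univ, hρ.lintegral_eq_one]⟩
  have hμ : ∀ T : Set ℝ, μ.real T ≤ M * volume.real (T ∩ Set.Icc 0 1) :=
    measureReal_density_le hρ.support_eq hM.le fun x hx => (hmM x hx).2
  have hη0 : 0 < κ / N := by positivity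
  have hη1 : κ / N ≤ 1 := by rw [div_le_one (by positivity)]; linarith
  have hNS : E < γ * (1 - 2 * (κ / N) * Fintype.card B) := by
    have h1 : κ / N * Fintype.card B ≤ κ := by
      calc κ / N * Fintype.card B ≤ κ / N * N := by gcongr
        _ = κ := by field_simp
    have h2 : γ * κ = (γ - E) / 4 := by rw [hκ]; field_simp
    nlinarith
  set hA := isHermitian_localFreeHamiltonian Λ
  set S : ℝ → ℝ → Set (B → ℝ) := fun c₀ c₁ => {x | ∃ i j, i ≠ j ∧
    level hA (siteBlock hr a) i x ∈ Set.Icc c₀ c₁ ∧ level hA (siteBlock hr a) j x ∈ Set.Icc c₀ c₁ ∧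
    |level hA (siteBlock hr a) i x - level hA (siteBlock hr a) j x| ≤ θ ^ (R + 1)} with hS
  have hbound : ∀ c₀ c₁ : ℝ, c₁ - c₀ = E → NonScalar hA (siteBlock hr a) (κ / N) (Set.Icc c₀ c₁) →
      (Measure.pi fun _ : B => μ).real (S c₀ c₁) ≤ C₀ * N ^ 7 * θ := by
    intro c₀ c₁ hc hns
    refine (measureReal_spacing_le hA (siteBlock hr a) (card_siteBlock_fiber_le hr a) hM.le hμ hη0 hη1
      (by linarith) hns hθ hθ').trans ?_
    rw [hcardN, hc]
    have e1 : N ^ 2 * (E / θ + 1) * (2 * (Fintype.card B * (M * (2 * (3 * θ)))) ^ 2)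
        ≤ 72 * (E + 1) * M ^ 2 * N ^ 7 * θ := by
      have h1 : E / θ + 1 ≤ (E + 1) / θ := by
        rw [add_div]
        have : 1 ≤ 1 / θ := by rw [le_div_iff₀ hθ]; linarith
        linarith
      calc N ^ 2 * (E / θ + 1) * (2 * (Fintype.card B * (M * (2 * (3 * θ)))) ^ 2)
          ≤ N ^ 2 * ((E + 1) / θ) * (2 * (N * (M * (2 * (3 * θ)))) ^ 2) := by gcongr
        _ = 72 * (E + 1) * M ^ 2 * N ^ 4 * θ := by field_simp; ring
        _ ≤ 72 * (E + 1) * M ^ 2 * N ^ 7 * θ := by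
          gcongr ?_ * ?_ * θ
          exact pow_le_pow_right₀ hN1 (by norm_num)
    have e2 : (R : ℝ) * N ^ 4 * Fintype.card B * (M * (576 * θ / (κ / N) ^ 2))
        ≤ 576 * R * M / κ ^ 2 * N ^ 7 * θ := by
      calc (R : ℝ) * N ^ 4 * Fintype.card B * (M * (576 * θ / (κ / N) ^ 2))
          ≤ R * N ^ 4 * N * (M * (576 * θ / (κ / N) ^ 2)) := by gcongr
        _ = 576 * R * M / κ ^ 2 * N ^ 7 * θ := by field_simp
    rw [hC₀, add_mul, add_mul]
    exact add_le_add e1 e2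
  have hlow := hbound 0 E (by ring) (nonScalar_lower hr a hNS)
  have hupp := hbound (4 * d + 1 - E) (4 * d + 1) (by ring) (nonScalar_upper hr a hNS)
  have hd' : (1 : ℝ) ≤ d := by exact_mod_cast hd
  have hθR : θ ^ (R + 1) ≤ 1 := pow_le_one₀ hθ.le hθ'
  have hmeas : Measurable fun η (k : B) => ω k.1 η := measurable_pi_lambda _ fun k => hω.measurable k.1
  have hsub : {η | levelSpacing (bandEdges d E) (isHermitian_localHamiltonian Λ
      (fun k => ω k η)) < (δ : EReal)}
      ⊆ (fun η (k : B) => ω k.1 η) ⁻¹' (S 0 E ∪ S (4 * d + 1 - E) (4 * d + 1)) := by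
    intro η hη
    obtain ⟨i, j, hij, hi, hj, hlt⟩ := exists_levels_of_levelSpacing_lt hr a (fun k => ω k η) hη
    have hle := hlt.le.trans hδ
    have habs := abs_lt.mp ((hlt.trans_le hδ).trans_le hθR)
    rcases hi with hi | hi <;> rcases hj with hj | hj
    · exact Or.inl ⟨i, j, hij, hi, hj, hle⟩
    · exfalso; linarith [hi.2, hj.1]
    · exfalso; linarith [hi.1, hj.2]
    · exact Or.inr ⟨i, j, hij, hi, hj, hle⟩
  have hP : P.real {η | levelSpacing (bandEdges d E) (isHermitian_localHamiltonian Λ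
      (fun k => ω k η)) < (δ : EReal)}
      ≤ (Measure.pi fun _ : B => μ).real (S 0 E ∪ S (4 * d + 1 - E) (4 * d + 1)) := by
    refine (measureReal_mono hsub).trans ?_
    rw [← map_coupling_eq_pi hω B]
    have : IsProbabilityMeasure (P.map fun η (k : B) => ω k.1 η) :=
      Measure.isProbabilityMeasure_map hmeas.aemeasurable
    exact ENNReal.toReal_mono (measure_ne_top _ _) (Measure.le_map_apply hmeas.aemeasurable _)
  refine hP.trans ((measureReal_union_le _ _).trans ?_)
  linarith

end Spacing

end AndersonModel

end

/-- Eigenvalue level spacing estimate for the Anderson model of rank `r ^ d` on `ℤ^d`, on cubes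
`Λ_L` of side length `L ∈ r ℕ` that are unions of blocks `Λ_r(k)`, `k ∈ r ℤ^d`. The constants do not
depend on `L`, `δ`, the position `a` of the cube, or the probability space. -/
theorem theorem4p1 (d r : ℕ) (hd : 1 ≤ d) (hr : 1 ≤ r) (ρ : ℝ → ℝ)
    (hρ : AndersonModel.IsSingleSiteDensity ρ) (E : ℝ) (hE : 0 < E)
    (hE' : E < 1 - Real.cos (Real.pi / r)) (p : ℝ) (hp : 0 < p) :
    ∃ Lsp Csp : ℝ, 0 < Lsp ∧ 0 < Csp ∧
      ∀ (Ω : Type*) [MeasurableSpace Ω] (P : Measure Ω) [IsProbabilityMeasure P]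
        (ω : AndersonModel.Sublattice d r → Ω → ℝ),
        AndersonModel.IsRandomCoupling P ρ ω →
        ∀ (L : ℕ) (a : AndersonModel.Sublattice d r) (δ : ℝ),
          r ∣ L → Lsp ≤ L → 0 < δ → δ ≤ Real.exp (-(Real.log L) ^ 5) →
          P.real {η | AndersonModel.levelSpacing (AndersonModel.bandEdges d E)
              (AndersonModel.isHermitian_localHamiltonian (AndersonModel.cube L a.1)
                (fun k => ω k η)) < (δ : EReal)}
            ≤ Csp * (L : ℝ) ^ (2 * d) * |Real.log δ| ^ (-p) := by
  obtain ⟨C, hC, hbound⟩ := AndersonModel.measureReal_levelSpacing_lt_le hd hr hρ hE hE'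
  have hexp : ∀ᶠ x : ℝ in Filter.atTop,
      x ^ (p / 2 * (9 * (r ^ d + 1) : ℕ)) ≤ Real.exp x := by
    have := (isLittleO_rpow_exp_atTop (p / 2 * (9 * (r ^ d + 1) : ℕ))).bound one_pos
    filter_upwards [this, Filter.eventually_ge_atTop 0] with x hx hx0
    rwa [one_mul, Real.norm_of_nonneg (Real.rpow_nonneg hx0 _),
      Real.norm_of_nonneg (Real.exp_pos x).le] at hx
  obtain ⟨l₀, hl₀⟩ := Filter.eventually_atTop.mp hexp
  refine ⟨Real.exp (max l₀ 1), C + 1, Real.exp_pos _, by linarith, ?_⟩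
  intro Ω _ P _ ω hω L a δ _ hL hδ hδL
  have hLpos : (0 : ℝ) < L := (Real.exp_pos _).trans_le hL
  have hL1 : 1 ≤ L := by exact_mod_cast hLpos
  have hlogL : max l₀ 1 ≤ Real.log L := (Real.le_log_iff_exp_le hLpos).mpr hL
  have hlogL1 : 1 ≤ Real.log L := (le_max_right _ _).trans hlogL
  set l := - Real.log δ with hl
  have hlL : Real.log L ^ 5 ≤ l := by
    have := (Real.log_le_iff_le_exp hδ).mpr hδL
    linarith
  have hlL' : Real.log L ≤ l := (le_self_pow₀ hlogL1 (by norm_num)).trans hlL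
  have hl1 : 1 ≤ l := hlogL1.trans hlL'
  have hl0 : 0 < l := by linarith
  have habs : |Real.log δ| = l := by rw [abs_of_nonpos (by linarith)]
  have hδexp : δ = (Real.exp l)⁻¹ := by rw [← Real.exp_neg, hl, neg_neg, Real.exp_log hδ]
  set t := l ^ (p / 2) with ht
  have ht1 : 1 ≤ t := Real.one_le_rpow hl1 (by positivity)
  have ht2 : l ^ (-p) = (t ^ 2)⁻¹ := by
    rw [Real.rpow_neg hl0.le, ht, ← Real.rpow_natCast, ← Real.rpow_mul hl0.le]
    congr 2
    push_cast
    ring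
  set N : ℝ := (L : ℝ) ^ d with hN
  have hN1 : 1 ≤ N := one_le_pow₀ (by exact_mod_cast hL1)
  have hN2 : (L : ℝ) ^ (2 * d) = N ^ 2 := by rw [hN, ← pow_mul, mul_comm]
  rw [habs, ht2, hN2]
  rcases le_total t N with hcase | hcase
  · refine (measureReal_le_one).trans ?_
    have h1 : 1 ≤ N ^ 2 * (t ^ 2)⁻¹ := by
      rw [← div_eq_mul_inv, le_div_iff₀ (by positivity), one_mul]
      gcongr
    nlinarith
  · have hθδ : δ ≤ ((t ^ 9)⁻¹) ^ (r ^ d + 1) := by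
      rw [hδexp, inv_pow, ← pow_mul]
      refine inv_anti₀ (by positivity) ?_
      have := hl₀ l ((le_max_left _ _).trans (hlogL.trans hlL'))
      rwa [Real.rpow_mul hl0.le, Real.rpow_natCast] at this
    refine (hbound Ω P ω hω L a (t ^ 9)⁻¹ δ hL1 (by positivity)
      (inv_le_one_of_one_le₀ (one_le_pow₀ ht1)) hθδ).trans ?_
    have h1 : N ^ 7 * (t ^ 9)⁻¹ ≤ (t ^ 2)⁻¹ := by
      calc N ^ 7 * (t ^ 9)⁻¹ ≤ t ^ 7 * (t ^ 9)⁻¹ := by gcongr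
        _ = (t ^ 2)⁻¹ := by field_simp
    have h2 : 1 ≤ N ^ 2 := one_le_pow₀ hN1
    have h3 : 0 < (t ^ 2)⁻¹ := by positivity
    calc C * N ^ 7 * (t ^ 9)⁻¹ = C * (N ^ 7 * (t ^ 9)⁻¹) := by ring
      _ ≤ C * (t ^ 2)⁻¹ := by gcongr
      _ ≤ (C + 1) * N ^ 2 * (t ^ 2)⁻¹ := by
        gcongr
        nlinarith
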